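/- Fix an integer $g\ge 0$ and let $\mathbb R\langle a,x\rangle$ be the algebra of real polynomials in the non-commuting variables $a=(a_1,\dots,a_g)$, $x=(x_1,\dots,x_g)$, with the linear involution ${}^T$ that reverses the order of letters in each word and fixes each variable; $p$ is symmetric if $p^T=p$. Let $\mathbb S_n(\mathbb R^g)$ be the space of $g$-tuples of real symmetric $n\times n$ matrices, and $p(A,X)$ the evaluation of $p$ at $A,X\in\mathbb S_n(\mathbb R^g)$. A (non-commutative) domain is a sequence $\mathcal U=(\mathcal U_n)_n$ of sets $\mathcal U_n\subset\mathbb S_n(\mathbb R^g)$ that is closed under direct sums: $X\in\mathcal U_m$ and $Y\in\mathcal U_n$ imply $X\oplus Y\in\mathcal U_{m+n}$. It is open if every $\mathcal U_n$ is open in $\mathbb S_n(\mathbb R^g)$. Write $\mathbb S(\mathbb R^g)=(\mathbb S_n(\mathbb R^g))_n$, and $\mathcal D\times\mathcal U=(\mathcal D_n\times\mathcal U_n)_n$. A polynomial $p$ is convex in $x$ on $\mathcal W=(\mathcal W_n)_n$, $\mathcal W_n\subset \mathbb S_n(\mathbb R^g)\times\mathbb S_n(\mathbb R^g)$, if for all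 $n$ and all $A,X,Y$ such that $(A,tX+(1-t)Y)\in\mathcal W_n$ for every $0\le t\le 1$, the matrix $$t\,p(A,X)+(1-t)\,p(A,Y)-p(A,tX+(1-t)Y)$$ is positive semidefinite for every $0\le t\le 1$. **Theorem.** Let $p\in\mathbb R\langle a,x\rangle$ be symmetric and let $\mathcal U$ be an open domain such that $\mathcal U_n\ne\emptyset$ for some $n\ge 1$. If $p$ is convex in $x$ on the product $\mathbb S(\mathbb R^g)\times\mathcal U$, then there are a polynomial $L$ of degree at most one in $x$ and a finite column vector $\Lambda=(\Lambda_1,\dots,\Lambda_m)^T$ of polynomials, each of which is linear in $x$ (every word occurring in it contains exactly one letter from $x$), such that $$p=L+\Lambda^T\Lambda=L+\sum_{i=1}^m\Lambda_i^T\Lambda_i .$$ Moreover, $p$ has degree at most two in $x$ and is convex in $x$ on $\mathbb S(\mathbb R^g)\times\mathbb S(\mathbb R^g)$. -/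

import Mathlib

/-- The space of real symmetric `n × n` matrices. -/
def SymMat (n : ℕ) : Submodule ℝ (Matrix (Fin n) (Fin n) ℝ) where
  carrier := {M | M.IsSymm}
  add_mem' := fun hA hB => hA.add hB
  zero_mem' := Matrix.isSymm_zero
  smul_mem' := fun c _ hA => hA.smul c

/-- The space of `g`-tuples of real symmetric `n × n` matrices. -/
abbrev SymTuple (g n : ℕ) : Type := Fin g → SymMat n

/-- The direct sum of two symmetric matrices, a block diagonal matrix. -/
def SymMat.directSum {m n : ℕ} (A : SymMat m) (B : SymMat n) : SymMat (m + n) :=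
  ⟨Matrix.reindex finSumFinEquiv finSumFinEquiv
      (Matrix.fromBlocks (A : Matrix (Fin m) (Fin m) ℝ) 0 0 (B : Matrix (Fin n) (Fin n) ℝ)), by
    have hA : (A : Matrix (Fin m) (Fin m) ℝ).IsSymm := A.2
    have hB : (B : Matrix (Fin n) (Fin n) ℝ).IsSymm := B.2
    exact (hA.fromBlocks (Matrix.transpose_zero) hB).submatrix _⟩

/-- The entrywise direct sum of two tuples of symmetric matrices. -/
def SymTuple.directSum {g m n : ℕ} (X : SymTuple g m) (Y : SymTuple g n) : SymTuple g (m + n) :=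
  fun j => SymMat.directSum (X j) (Y j)

/-- A non-commutative domain in `g` variables: a sequence of sets `D n` of `g`-tuples of symmetric
`n × n` matrices which is closed under direct sums. -/
structure NCDomain (g : ℕ) where
  level : (n : ℕ) → Set (SymTuple g n)
  directSum_mem : ∀ {m n : ℕ} {X : SymTuple g m} {Y : SymTuple g n},
    X ∈ level m → Y ∈ level n → X.directSum Y ∈ level (m + n)

/-- A non-commutative domain is open if it is open at every level. -/
def NCDomain.IsOpen {g : ℕ} (D : NCDomain g) : Prop :=
  ∀ n : ℕ, _root_.IsOpen (D.level n)

/-- The domain of all tuples of symmetric matrices. -/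
def NCDomain.all (g : ℕ) : NCDomain g where
  level := fun _ => Set.univ
  directSum_mem := fun _ _ => Set.mem_univ _

/-- The levels of the product of two domains, the first in the `a`-variables and the second in
the `x`-variables. -/
def NCDomain.prod {g : ℕ} (D E : NCDomain g) (n : ℕ) : Set (SymTuple g n × SymTuple g n) :=
  D.level n ×ˢ E.level n

/-- Polynomials with real coefficients in the non-commuting variables `a_j` (the letters
`Sum.inl j`) and `x_j` (the letters `Sum.inr j`). The involution is Mathlib's `star` on the free
algebra: it is linear, reverses the order of products and fixes every variable. -/
abbrev NCPoly (g : ℕ) : Type := FreeAlgebra ℝ (Fin g ⊕ Fin g)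

/-- The set of words that occur in `p` with a non-zero coefficient. -/
noncomputable def NCPoly.words {g : ℕ} (p : NCPoly g) : Finset (FreeMonoid (Fin g ⊕ Fin g)) :=
  (FreeAlgebra.equivMonoidAlgebraFreeMonoid p).coeff.support

/-- The degree in `x` of a word: the number of letters of type `x`. -/
def wordDegX {g : ℕ} (w : FreeMonoid (Fin g ⊕ Fin g)) : ℕ :=
  w.toList.countP Sum.isRight

/-- `p` has degree at most `d` in `x`. -/
def NCPoly.DegXLE {g : ℕ} (p : NCPoly g) (d : ℕ) : Prop :=
  ∀ w ∈ p.words, wordDegX w ≤ d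

/-- `p` is linear in `x`, that is, homogeneous of degree one in `x`. -/
def NCPoly.IsLinearInX {g : ℕ} (p : NCPoly g) : Prop :=
  ∀ w ∈ p.words, wordDegX w = 1

/-- The evaluation `p(A, X)`. -/
noncomputable def NCPoly.evalAt {g n : ℕ} (p : NCPoly g) (A X : SymTuple g n) :
    Matrix (Fin n) (Fin n) ℝ :=
  FreeAlgebra.lift ℝ
    (Sum.elim (fun j => (A j : Matrix (Fin n) (Fin n) ℝ))
      (fun j => (X j : Matrix (Fin n) (Fin n) ℝ))) p

/-- `p` is convex in `x` on `W`: the convexity inequality holds, in the order of positive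
semidefinite matrices, along every segment `{A} × [X, Y]` that lies in `W`. -/
def NCPoly.ConvexInXOn {g : ℕ} (p : NCPoly g)
    (W : (n : ℕ) → Set (SymTuple g n × SymTuple g n)) : Prop :=
  ∀ (n : ℕ) (A X Y : SymTuple g n),
    (∀ t : ℝ, 0 ≤ t → t ≤ 1 → (A, t • X + (1 - t) • Y) ∈ W n) →
    ∀ t : ℝ, 0 ≤ t → t ≤ 1 →
      (t • p.evalAt A X + (1 - t) • p.evalAt A Y
        - p.evalAt A (t • X + (1 - t) • Y)).PosSemidef

/-!
Convexity at the points of an open domain makes the Hessian of `p` in the direction `H`, which is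
the coefficient of `t ^ 2` in `p (A, X + t H)`, positive semidefinite at all `X` in the domain, for
all `A` and `H` (`hessian_nonneg`).

*Degree at most two.* By closure under direct sums, the domain contains points of arbitrarily large
size, and a determinant argument along a line gives a point at which the vectors `w(A, X) ξ`, for
all words `w` up to a given length, are linearly independent (`exists_mem_level_isDualFamily`). On
the direct sum of two copies of such a point, an off-diagonal direction `H` can take these vectors
to arbitrary vectors of the second copy. The Hessian at `ξ` is then a quadratic form in
the chosen vectors; its entries belong to pairs of words `a`, `b` starting with an `x`-letter and
involve the coefficients of the words `aᵀ m b` of `p`. If `p` had degree `d > 2`, some diagonal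
entry would vanish for reasons of degree while an entry in the same row would not, which contradicts
positivity (`NCPoly.ConvexInXOn.degXLE_two`).

*Sum of squares.* If `p` has degree at most two, the Hessian is the part `p₂` of degree two,
evaluated at `(A, H)`. Hence `p₂` is positive semidefinite at all tuples of symmetric matrices of
all sizes, and Helton's theorem (`exists_eq_sum_star_mul_self`) writes it as a sum of squares. That
theorem is proved by duality: if `p₂` is not a sum of squares of polynomials with short words, the
separation theorem of Hahn and Banach gives a functional that is strictly positive on squares and
negative at `p₂`, and its truncated Gelfand-Naimark-Segal representation is a tuple of symmetric
matrices at which `p₂` is not positive. The parts of degree zero of the terms have squares that sum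
to zero, so they vanish and only the linear parts contribute (`xPart_two_sum_star_mul_self`).

*Convexity everywhere* follows from the formula `p = L + ∑ Λᵢᵀ Λᵢ`, because `L` and the `Λᵢ` are
affine in `x` (`convexInXOn_of_eq_add_sum`).
-/

/-! ### Words and coefficients in the free algebra -/

section Words

variable {σ : Type*}

/-- The basis of the free algebra that consists of the words, indexed by lists of letters. -/
noncomputable def wordBasis (σ : Type*) : Module.Basis (List σ) ℝ (FreeAlgebra ℝ σ) :=
  (FreeAlgebra.basisFreeMonoid ℝ σ).reindex FreeMonoid.toList

theorem wordBasis_apply (w : List σ) :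
    wordBasis σ w = (w.map (FreeAlgebra.ι ℝ)).prod := by
  have h : wordBasis σ w = FreeAlgebra.equivMonoidAlgebraFreeMonoid.symm
      (MonoidAlgebra.of ℝ (FreeMonoid σ) (FreeMonoid.ofList w)) := by
    simp [wordBasis, FreeAlgebra.basisFreeMonoid]
  rw [h, AlgEquiv.symm_apply_eq, map_list_prod, List.map_map]
  clear h
  induction w with
  | nil => rfl
  | cons l w ih =>
    rw [FreeMonoid.ofList_cons, map_mul, ih, List.map_cons, List.prod_cons]
    simp [FreeAlgebra.equivMonoidAlgebraFreeMonoid]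

theorem wordBasis_nil : wordBasis σ [] = 1 := by simp [wordBasis_apply]

theorem wordBasis_append (v w : List σ) :
    wordBasis σ (v ++ w) = wordBasis σ v * wordBasis σ w := by
  simp [wordBasis_apply]

theorem lift_wordBasis {R : Type*} [Semiring R] [Algebra ℝ R] (M : σ → R) (w : List σ) :
    FreeAlgebra.lift ℝ M (wordBasis σ w) = (w.map M).prod := by
  rw [wordBasis_apply, map_list_prod, List.map_map]
  congr 2
  ext l
  simp

theorem FreeAlgebra.star_smul_real (c : ℝ) (p : FreeAlgebra ℝ σ) : star (c • p) = c • star p := by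
  rw [Algebra.smul_def, star_mul, FreeAlgebra.star_algebraMap, Algebra.smul_def,
    Algebra.commutes]

/-- The involution of the free algebra as a linear map. -/
noncomputable def starLinear (σ : Type*) : FreeAlgebra ℝ σ →ₗ[ℝ] FreeAlgebra ℝ σ where
  toFun := star
  map_add' := star_add
  map_smul' := FreeAlgebra.star_smul_real

theorem star_wordBasis (w : List σ) : star (wordBasis σ w) = wordBasis σ w.reverse := by
  induction w with
  | nil => simp [wordBasis_nil]
  | cons l w ih =>
    have h : wordBasis σ [l] = FreeAlgebra.ι ℝ l := by simp [wordBasis_apply]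
    rw [← List.singleton_append, wordBasis_append, star_mul, ih, h, FreeAlgebra.star_ι, ← h,
      ← wordBasis_append, List.reverse_append, List.reverse_singleton]

theorem repr_star (p : FreeAlgebra ℝ σ) (w : List σ) :
    (wordBasis σ).repr (star p) w = (wordBasis σ).repr p w.reverse := by
  have h : (Finsupp.lapply w ∘ₗ (wordBasis σ).repr.toLinearMap) ∘ₗ starLinear σ =
      Finsupp.lapply w.reverse ∘ₗ (wordBasis σ).repr.toLinearMap := by
    refine (wordBasis σ).ext fun v => ?_
    have : starLinear σ (wordBasis σ v) = wordBasis σ v.reverse := star_wordBasis v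
    simp only [LinearMap.comp_apply, this, LinearEquiv.coe_coe, Module.Basis.repr_self,
      Finsupp.lapply_apply]
    classical
    simp only [Finsupp.single_apply, List.reverse_eq_iff]
  exact LinearMap.congr_fun h p

theorem lift_eq_sum {R : Type*} [Semiring R] [Algebra ℝ R] (M : σ → R) (p : FreeAlgebra ℝ σ) :
    FreeAlgebra.lift ℝ M p =
      ((wordBasis σ).repr p).sum fun w c => c • (w.map M).prod := by
  conv_lhs => rw [← (wordBasis σ).linearCombination_repr p]
  rw [Finsupp.linearCombination_apply, Finsupp.sum, map_sum]
  simp [lift_wordBasis, Finsupp.sum]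

theorem NCPoly.mem_words_iff {g : ℕ} (p : NCPoly g) (w : FreeMonoid (Fin g ⊕ Fin g)) :
    w ∈ p.words ↔ (wordBasis _).repr p w.toList ≠ 0 := by
  simp [NCPoly.words, wordBasis, FreeAlgebra.basisFreeMonoid]

end Words

/-! ### Evaluation at symmetric matrices -/

section Evaluation

open Matrix

variable {σ ι κ : Type*} [Fintype ι] [DecidableEq ι] [Fintype κ] [DecidableEq κ]

theorem transpose_prod_of_isSymm {M : σ → Matrix ι ι ℝ} (hM : ∀ l, (M l).IsSymm) (w : List σ) :
    (w.map M).prodᵀ = (w.reverse.map M).prod := by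
  induction w with
  | nil => simp
  | cons l w ih => simp [ih, (hM l).eq]

theorem lift_star_of_isSymm {M : σ → Matrix ι ι ℝ} (hM : ∀ l, (M l).IsSymm)
    (p : FreeAlgebra ℝ σ) :
    FreeAlgebra.lift ℝ M (star p) = (FreeAlgebra.lift ℝ M p)ᵀ := by
  have h : (FreeAlgebra.lift ℝ M).toLinearMap ∘ₗ starLinear σ =
      (transposeLinearEquiv ι ι ℝ ℝ).toLinearMap ∘ₗ (FreeAlgebra.lift ℝ M).toLinearMap := by
    refine (wordBasis σ).ext fun w => ?_
    have : starLinear σ (wordBasis σ w) = wordBasis σ w.reverse := star_wordBasis w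
    simp [this, lift_wordBasis, transpose_prod_of_isSymm hM]
  exact LinearMap.congr_fun h p

theorem prod_mul_of_intertwines {M : σ → Matrix ι ι ℝ} {M' : σ → Matrix κ κ ℝ}
    {E : Matrix κ ι ℝ} (h : ∀ l, M' l * E = E * M l) (w : List σ) :
    (w.map M').prod * E = E * (w.map M).prod := by
  induction w with
  | nil => simp
  | cons l w ih => simp only [List.map_cons, List.prod_cons, Matrix.mul_assoc, ih]
                   rw [← Matrix.mul_assoc, h, Matrix.mul_assoc]

theorem lift_mul_of_intertwines {M : σ → Matrix ι ι ℝ} {M' : σ → Matrix κ κ ℝ}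
    {E : Matrix κ ι ℝ} (h : ∀ l, M' l * E = E * M l) (p : FreeAlgebra ℝ σ) :
    FreeAlgebra.lift ℝ M' p * E = E * FreeAlgebra.lift ℝ M p := by
  simp only [lift_eq_sum, Finsupp.sum, Matrix.sum_mul, Matrix.mul_sum, smul_mul, Matrix.mul_smul,
    prod_mul_of_intertwines h]

/-- The matrix of the isometry that sends the basis vectors of `ℝ^ι` to basis vectors of `ℝ^κ`
along an embedding of index sets. -/
def embMatrix (f : ι ↪ κ) : Matrix κ ι ℝ := fun k i => if k = f i then 1 else 0

omit [Fintype ι] in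
theorem embMatrix_transpose_mul (f : ι ↪ κ) : (embMatrix f)ᵀ * embMatrix f = 1 := by
  ext i j
  simp [Matrix.mul_apply, embMatrix, Matrix.one_apply, eq_comm]

theorem embMatrix_intertwines (f : ι ↪ κ) (M : Matrix ι ι ℝ) :
    (embMatrix f * M * (embMatrix f)ᵀ) * embMatrix f = embMatrix f * M := by
  rw [Matrix.mul_assoc, embMatrix_transpose_mul, Matrix.mul_one]

omit [DecidableEq ι] [Fintype κ] [DecidableEq κ] in
theorem Matrix.IsSymm.conj_transpose {M : Matrix ι ι ℝ} (hM : M.IsSymm) (E : Matrix κ ι ℝ) :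
    (E * M * Eᵀ).IsSymm := by
  simp [Matrix.IsSymm, Matrix.transpose_mul, hM.eq, Matrix.mul_assoc]

end Evaluation

/-! ### Matrix pencils with polynomial entries -/

section Pencil

open Matrix Polynomial

variable {σ ι : Type*} [Fintype ι] [DecidableEq ι]

/-- The tuple `M + t H` as a tuple of matrices over the polynomial ring in `t`. -/
noncomputable def pencil (M H : σ → Matrix ι ι ℝ) (l : σ) : Matrix ι ι ℝ[X] :=
  (M l).map C + (X : ℝ[X]) • (H l).map C

theorem prod_pencil_map_eval (M H : σ → Matrix ι ι ℝ) (w : List σ) (t : ℝ) :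
    ((w.map (pencil M H)).prod).map (eval t) = (w.map fun l => M l + t • H l).prod := by
  have h : ∀ Q : Matrix ι ι ℝ[X], Q.map (eval t) = (evalRingHom t).mapMatrix Q := fun Q => rfl
  rw [h, map_list_prod, List.map_map]
  congr 2
  funext l
  ext i j
  simp [pencil, mul_comm t]

theorem lift_pencil_map_eval (M H : σ → Matrix ι ι ℝ) (p : FreeAlgebra ℝ σ) (t : ℝ) :
    (FreeAlgebra.lift ℝ (pencil M H) p).map (eval t) =
      FreeAlgebra.lift ℝ (fun l => M l + t • H l) p := by
  ext i j
  rw [lift_eq_sum, lift_eq_sum, Matrix.map_apply, Finsupp.sum, Finsupp.sum, Matrix.sum_apply,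
    Matrix.sum_apply, eval_finsetSum]
  refine Finset.sum_congr rfl fun w _ => ?_
  rw [← prod_pencil_map_eval, Matrix.smul_apply, Matrix.smul_apply, Matrix.map_apply, eval_smul]

/-- The matrix of the coefficients of `t ^ k` of a matrix with polynomial entries. -/
def coeffMatrix (k : ℕ) (Q : Matrix ι ι ℝ[X]) : Matrix ι ι ℝ := fun i j => (Q i j).coeff k

theorem coeffMatrix_zero_prod_pencil_cons (M H : σ → Matrix ι ι ℝ) (l : σ) (w : List σ) :
    coeffMatrix 0 (((l :: w).map (pencil M H)).prod) =
      M l * coeffMatrix 0 ((w.map (pencil M H)).prod) := by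
  ext i j
  simp [coeffMatrix, pencil, Matrix.mul_apply, add_mul, mul_assoc]

theorem coeffMatrix_succ_prod_pencil_cons (M H : σ → Matrix ι ι ℝ) (k : ℕ) (l : σ)
    (w : List σ) :
    coeffMatrix (k + 1) (((l :: w).map (pencil M H)).prod) =
      M l * coeffMatrix (k + 1) ((w.map (pencil M H)).prod) +
        H l * coeffMatrix k ((w.map (pencil M H)).prod) := by
  ext i j
  simp [coeffMatrix, pencil, Matrix.mul_apply, add_mul, mul_assoc,
    Finset.sum_add_distrib, coeff_X_mul]

theorem coeffMatrix_lift (M H : σ → Matrix ι ι ℝ) (k : ℕ) (p : FreeAlgebra ℝ σ) :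
    coeffMatrix k (FreeAlgebra.lift ℝ (pencil M H) p) =
      ((wordBasis σ).repr p).sum fun w c => c • coeffMatrix k ((w.map (pencil M H)).prod) := by
  ext i j
  simp [coeffMatrix, lift_eq_sum, Finsupp.sum, Matrix.sum_apply]

omit [DecidableEq ι] in
/-- The quadratic form of a polynomial matrix, as a polynomial. -/
theorem exists_polynomial_quadraticForm (Q : Matrix ι ι ℝ[X]) (ξ : ι → ℝ) :
    ∃ f : ℝ[X], (∀ t, f.eval t = ξ ⬝ᵥ (Q.map (eval t)) *ᵥ ξ) ∧
      ∀ k, f.coeff k = ξ ⬝ᵥ coeffMatrix k Q *ᵥ ξ := by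
  refine ⟨∑ i, C (ξ i) * ∑ j, Q i j * C (ξ j), fun t => ?_, fun k => ?_⟩
  · simp [dotProduct, Matrix.mulVec, eval_finsetSum]
  · simp [dotProduct, Matrix.mulVec, coeffMatrix]

theorem Polynomial.exists_eval_ne_zero_of_lt {f : ℝ[X]} (hf : f ≠ 0) {ε : ℝ} (hε : 0 < ε) :
    ∃ t, 0 < t ∧ t < ε ∧ f.eval t ≠ 0 := by
  by_contra! h
  refine hf (eq_zero_of_infinite_isRoot f ((Set.Ioo_infinite hε).mono fun t ht => ?_))
  exact h t ht.1 ht.2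

/-- If the second difference of a polynomial at `0` is non-negative for small steps, then the
coefficient of `t ^ 2` is non-negative. -/
theorem Polynomial.coeff_two_nonneg {f : ℝ[X]} {ε : ℝ} (hε : 0 < ε)
    (h : ∀ t, 0 < t → t < ε → 0 ≤ f.eval t + f.eval (-t) - 2 * f.eval 0) : 0 ≤ f.coeff 2 := by
  obtain ⟨q, hq⟩ : ∃ q : ℝ[X], f + f.comp (-X) - 2 * C (f.eval 0) = X ^ 2 * q := by
    refine X_pow_dvd_iff.2 fun d hd => ?_
    interval_cases d
    · simp [coeff_zero_eq_eval_zero, two_mul]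
    · have : f.comp (-X) = f.comp (C (-1) * X) := by simp
      rw [this, coeff_sub, coeff_add, comp_C_mul_X_coeff, coeff_ofNat_mul, coeff_C]
      simp
  have hc : q.eval 0 = 2 * f.coeff 2 := by
    have h2 := congrArg (fun r => r.coeff 2) hq
    have : f.comp (-X) = f.comp (C (-1) * X) := by simp
    simp only [this, coeff_sub, coeff_add, comp_C_mul_X_coeff, coeff_ofNat_mul, coeff_C] at h2
    rw [coeff_X_pow_mul' ] at h2
    simp [coeff_zero_eq_eval_zero] at h2
    linarith
  have hpos : ∀ t, 0 < t → t < ε → 0 ≤ q.eval t := by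
    intro t ht ht'
    have h1 := h t ht ht'
    have h2 := congrArg (eval t) hq
    simp only [eval_sub, eval_add, eval_comp, eval_mul, eval_neg, eval_X, eval_C, eval_pow,
      eval_ofNat] at h2
    rw [h2] at h1
    exact nonneg_of_mul_nonneg_right h1 (by positivity)
  have hlim : 0 ≤ q.eval 0 := by
    refine ge_of_tendsto (x := nhdsWithin 0 (Set.Ioi 0)) (f := fun t => q.eval t)
      (q.continuous.continuousAt.tendsto.mono_left nhdsWithin_le_nhds) ?_
    filter_upwards [Ioo_mem_nhdsGT hε] with t ht using hpos t ht.1 ht.2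
  linarith

end Pencil

/-! ### Vectors on which short words act freely -/

section Free

open Matrix Polynomial

variable {σ ι κ : Type*} [Fintype ι] [DecidableEq ι] [Fintype κ] [DecidableEq κ]

/-- The vectors `w(M) ξ`, for words `w` of length at most `D`, are linearly independent; this is
expressed by a dual family `L`. -/
def IsDualFamily [DecidableEq σ] (D : ℕ) (M : σ → Matrix ι ι ℝ) (ξ : ι → ℝ)
    (L : List σ → ι → ℝ) : Prop :=
  ∀ v w : List σ, v.length ≤ D → w.length ≤ D →
    L v ⬝ᵥ ((w.map M).prod *ᵥ ξ) = if v = w then 1 else 0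

/-- The words of length at most `D`. -/
abbrev ShortWord (σ : Type*) (D : ℕ) : Type _ := {w : List σ // w.length ≤ D}

noncomputable instance [Finite σ] (D : ℕ) : Fintype (ShortWord σ D) :=
  (List.finite_length_le σ D).fintype

variable [DecidableEq σ]

/-- On the space with basis the short words, the sum of the operator that prepends the letter `l`
to a word and of its transpose. -/
def shiftMatrix (D : ℕ) (l : σ) : Matrix (ShortWord σ D) (ShortWord σ D) ℝ :=
  fun v w => (if v.1 = l :: w.1 then 1 else 0) + if w.1 = l :: v.1 then 1 else 0

theorem shiftMatrix_isSymm (D : ℕ) (l : σ) : (shiftMatrix D l).IsSymm := by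
  ext v w
  simp [shiftMatrix, add_comm]

/-- The vector `w(M) e_∅` is the sum of `e_w` and of basis vectors that belong to shorter words. -/
theorem prod_shiftMatrix_mulVec_apply [Finite σ] (D : ℕ) (w : List σ) (v : ShortWord σ D)
    (hv : w.length ≤ v.1.length) :
    ((w.map (shiftMatrix D)).prod *ᵥ Pi.single ⟨[], Nat.zero_le D⟩ 1) v =
      if v.1 = w then 1 else 0 := by
  induction w generalizing v with
  | nil =>
    rw [List.map_nil, List.prod_nil, Matrix.one_mulVec]
    simp only [Pi.single_apply, Subtype.ext_iff]
  | cons l w ih =>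
    rw [List.map_cons, List.prod_cons, ← Matrix.mulVec_mulVec]
    set z := (w.map (shiftMatrix D)).prod *ᵥ Pi.single ⟨[], Nat.zero_le D⟩ 1
    have hvD := v.2
    rw [List.length_cons] at hv
    have hterm : ∀ u : ShortWord σ D, shiftMatrix D l v u * z u =
        if u.1 = w then (if v.1 = l :: w then 1 else 0) else 0 := by
      intro u
      unfold shiftMatrix
      by_cases h1 : u.1 = l :: v.1
      · have hu : u.1.length = v.1.length + 1 := by rw [h1, List.length_cons]
        have h2 : ¬ u.1 = w := fun h => by rw [h] at hu; omega
        rw [ih u (by omega)]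
        simp [h2]
      · by_cases h3 : v.1 = l :: u.1
        · have hu : v.1.length = u.1.length + 1 := by rw [h3, List.length_cons]
          rw [ih u (by omega)]
          by_cases h4 : u.1 = w
          · simp [h3, h4]
            intro h
            have h5 := congrArg List.length h
            simp only [List.length_cons] at h5
            omega
          · simp [h4]
        · by_cases h4 : u.1 = w
          · rw [h4] at h3 h1; simp [h1, h3, h4]
          · simp [h1, h3, h4]
    rw [Matrix.mulVec, dotProduct, Finset.sum_congr rfl fun u _ => hterm u,
      Finset.sum_eq_single ⟨w, by omega⟩]
    · simp
    · intro u _ hu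
      rw [if_neg fun h => hu (Subtype.ext h)]
    · simp

theorem exists_isDualFamily_shiftMatrix [Finite σ] (D : ℕ) :
    ∃ L, IsDualFamily D (shiftMatrix (σ := σ) D) (Pi.single ⟨[], Nat.zero_le D⟩ 1) L := by
  let Z : Matrix (ShortWord σ D) (ShortWord σ D) ℝ := fun u w =>
    ((w.1.map (shiftMatrix D)).prod *ᵥ Pi.single ⟨[], Nat.zero_le D⟩ 1) u
  have hZ : IsUnit Z := by
    rw [← Matrix.mulVec_injective_iff_isUnit]
    refine (injective_iff_map_eq_zero' (Matrix.mulVecLin Z)).2 fun c => ⟨fun hc => ?_, ?_⟩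
    · by_contra hne
      -- A word of maximal length among those with a non-zero coefficient.
      obtain ⟨w, hw, hmax⟩ := Finset.exists_max_image
        (Finset.univ.filter fun w => c w ≠ 0) (fun w => w.1.length)
        (by
          obtain ⟨w, hw⟩ := Function.ne_iff.1 hne
          exact ⟨w, by simpa using hw⟩)
      have h0 := congrFun hc w
      simp only [Matrix.mulVecLin_apply, Matrix.mulVec, dotProduct, Pi.zero_apply] at h0
      rw [Finset.sum_eq_single w] at h0
      · have : Z w w = 1 := by
          simp only [Z]
          rw [prod_shiftMatrix_mulVec_apply D w.1 w le_rfl, if_pos rfl]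
        rw [this, one_mul] at h0
        exact (Finset.mem_filter.1 hw).2 h0
      · intro u _ hu
        by_cases hcu : c u = 0
        · rw [hcu, mul_zero]
        · have hle := hmax u (by simpa using hcu)
          have : Z w u = 0 := by
            simp only [Z]
            rw [prod_shiftMatrix_mulVec_apply D u.1 w hle,
              if_neg fun h => hu (Subtype.ext h.symm)]
          rw [this, zero_mul]
      · simp
    · rintro rfl
      simp
  refine ⟨fun v u => if hv : v.length ≤ D then Z⁻¹ ⟨v, hv⟩ u else 0, fun v w hv hw => ?_⟩
  have h := congrFun (congrFun (Matrix.nonsing_inv_mul Z ((Matrix.isUnit_iff_isUnit_det Z).1 hZ))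
    ⟨v, hv⟩) ⟨w, hw⟩
  rw [Matrix.mul_apply, Matrix.one_apply] at h
  simpa [hv, dotProduct, Z] using h

/-- In every sufficiently large size there are symmetric matrices and a vector on which the short
words act freely. -/
theorem exists_isSymm_isDualFamily [Finite σ] (D : ℕ)
    (hκ : Fintype.card (ShortWord σ D) ≤ Fintype.card κ) :
    ∃ (M : σ → Matrix κ κ ℝ) (ξ : κ → ℝ) (L : List σ → κ → ℝ),
      (∀ l, (M l).IsSymm) ∧ IsDualFamily D M ξ L := by
  obtain ⟨f⟩ := Function.Embedding.nonempty_of_card_le hκ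
  obtain ⟨L, hL⟩ := exists_isDualFamily_shiftMatrix (σ := σ) D
  refine ⟨fun l => embMatrix f * shiftMatrix D l * (embMatrix f)ᵀ,
    embMatrix f *ᵥ Pi.single ⟨[], Nat.zero_le D⟩ 1, fun v => embMatrix f *ᵥ L v,
    fun l => (shiftMatrix_isSymm D l).conj_transpose _, fun v w hv hw => ?_⟩
  rw [Matrix.mulVec_mulVec, prod_mul_of_intertwines fun l => embMatrix_intertwines f _,
    ← Matrix.mulVec_mulVec, Matrix.dotProduct_mulVec, Matrix.vecMul_mulVec,
    embMatrix_transpose_mul, Matrix.vecMul_one]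
  exact hL v w hv hw

/-- Freeness on short words is an open condition along a line, because it is the non-vanishing of
a determinant that is polynomial in the parameter. -/
theorem IsDualFamily.exists_small [Finite σ] {D : ℕ} {M H : σ → Matrix ι ι ℝ} {ξ : ι → ℝ}
    {L : List σ → ι → ℝ} (h : IsDualFamily D (fun l => M l + H l) ξ L) {ε : ℝ} (hε : 0 < ε) :
    ∃ t, 0 < t ∧ t < ε ∧ ∃ L', IsDualFamily D (fun l => M l + t • H l) ξ L' := by
  let Q : Matrix (ShortWord σ D) (ShortWord σ D) ℝ[X] := fun v w =>
    ∑ i, C (L v.1 i) * ∑ j, ((w.1.map (pencil M H)).prod) i j * C (ξ j)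
  have hQ : ∀ t v w, eval t (Q v w) =
      L v.1 ⬝ᵥ ((w.1.map fun l => M l + t • H l).prod *ᵥ ξ) := by
    intro t v w
    simp [Q, ← prod_pencil_map_eval, eval_finsetSum, dotProduct, Matrix.mulVec]
  have hdet : ∀ t, eval t Q.det = (Q.map (eval t)).det := fun t =>
    (evalRingHom t).map_det Q
  have h1 : eval 1 Q.det = 1 := by
    rw [hdet]
    suffices this : Q.map (eval 1) = 1 by rw [this, Matrix.det_one]
    ext v w
    rw [Matrix.map_apply, hQ, Matrix.one_apply]
    simp only [one_smul]
    rw [h v.1 w.1 v.2 w.2]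
    simp only [Subtype.ext_iff]
  obtain ⟨t, ht, htε, hne⟩ := Polynomial.exists_eval_ne_zero_of_lt
    (f := Q.det) (fun h0 => by simp [h0] at h1) hε
  refine ⟨t, ht, htε,
    fun v i => if hv : v.length ≤ D then ∑ u, (Q.map (eval t))⁻¹ ⟨v, hv⟩ u * L u.1 i else 0,
    fun v w hv hw => ?_⟩
  have hinv := congrFun (congrFun (Matrix.nonsing_inv_mul (Q.map (eval t))
    (isUnit_iff_ne_zero.2 (hdet t ▸ hne))) ⟨v, hv⟩) ⟨w, hw⟩
  rw [Matrix.mul_apply, Matrix.one_apply] at hinv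
  simp only [Matrix.map_apply, hQ, Subtype.mk.injEq] at hinv
  rw [← hinv]
  simp only [hv, dite_true, dotProduct, Finset.sum_mul, Finset.mul_sum, mul_assoc]
  exact Finset.sum_comm

end Free

/-! ### Positive polynomials are sums of squares -/

section SumOfSquares

open Matrix

variable {σ : Type} [Finite σ] [DecidableEq σ] {ι : Type*} [Fintype ι] [DecidableEq ι]

/-- The polynomial with Gram matrix `G` with respect to the short words. -/
noncomputable def gramMap (σ : Type) [Finite σ] (D : ℕ) :
    Matrix (ShortWord σ D) (ShortWord σ D) ℝ →ₗ[ℝ] FreeAlgebra ℝ σ where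
  toFun G := ∑ v, ∑ w, G v w • wordBasis σ (v.1.reverse ++ w.1)
  map_add' G G' := by simp [add_smul, Finset.sum_add_distrib]
  map_smul' c G := by simp [Finset.smul_sum, smul_smul]

/-- The polynomial with prescribed coefficients of the short words. -/
noncomputable def shortPoly {D : ℕ} (c : ShortWord σ D → ℝ) : FreeAlgebra ℝ σ :=
  ∑ w, c w • wordBasis σ w.1

omit [DecidableEq σ] in
theorem gramMap_transpose_mul_self {D : ℕ}
    (R : Matrix (ShortWord σ D) (ShortWord σ D) ℝ) :
    gramMap σ D (Rᵀ * R) = ∑ k, star (shortPoly (R k)) * shortPoly (R k) := by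
  have h : ∀ k, star (shortPoly (R k)) * shortPoly (R k) =
      ∑ v, ∑ w, (R k v * R k w) • wordBasis σ (v.1.reverse ++ w.1) := by
    intro k
    simp only [shortPoly, star_sum, FreeAlgebra.star_smul_real, star_wordBasis,
      Finset.sum_mul_sum, smul_mul_smul_comm, wordBasis_append]
  simp only [h, gramMap, LinearMap.coe_mk, AddHom.coe_mk, Matrix.mul_apply,
    Matrix.transpose_apply, Finset.sum_smul]
  rw [Finset.sum_comm (γ := ShortWord σ D)]
  conv_rhs => rw [Finset.sum_comm]
  rw [Finset.sum_comm]
  refine Finset.sum_congr rfl fun v _ => ?_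
  rw [Finset.sum_comm]

omit [Finite σ] [DecidableEq σ] in
theorem dotProduct_lift_star_mul_self {M : σ → Matrix ι ι ℝ} (hM : ∀ l, (M l).IsSymm)
    (q : FreeAlgebra ℝ σ) (ξ : ι → ℝ) :
    ξ ⬝ᵥ FreeAlgebra.lift ℝ M (star q * q) *ᵥ ξ =
      (FreeAlgebra.lift ℝ M q *ᵥ ξ) ⬝ᵥ (FreeAlgebra.lift ℝ M q *ᵥ ξ) := by
  rw [map_mul, lift_star_of_isSymm hM, ← Matrix.mulVec_mulVec, Matrix.dotProduct_mulVec,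
    Matrix.vecMul_transpose]

theorem IsDualFamily.coeff_eq {D : ℕ} {M : σ → Matrix ι ι ℝ} {ξ : ι → ℝ}
    {L : List σ → ι → ℝ} (h : IsDualFamily D M ξ L) (c : ShortWord σ D → ℝ)
    (v : ShortWord σ D) :
    L v.1 ⬝ᵥ (FreeAlgebra.lift ℝ M (shortPoly c) *ᵥ ξ) = c v := by
  simp only [shortPoly, map_sum, map_smul, lift_wordBasis, Matrix.sum_mulVec, dotProduct_sum,
    Matrix.smul_mulVec, dotProduct_smul, smul_eq_mul]
  rw [Finset.sum_eq_single v]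
  · rw [h v.1 v.1 v.2 v.2, if_pos rfl, mul_one]
  · intro w _ hw
    rw [h v.1 w.1 v.2 w.2, if_neg fun h => hw (Subtype.ext h.symm), mul_zero]
  · simp

/-- A sum of squares whose evaluations are all negative semidefinite has no non-zero term. -/
theorem eq_zero_of_sum_star_mul_self_nonpos {κ : Type*} [Fintype κ] {D : ℕ}
    (c : κ → ShortWord σ D → ℝ)
    (h : ∀ (M : σ → Matrix (ShortWord σ D) (ShortWord σ D) ℝ) (ξ : ShortWord σ D → ℝ),
      (∀ l, (M l).IsSymm) →
      ξ ⬝ᵥ FreeAlgebra.lift ℝ M (∑ k, star (shortPoly (c k)) * shortPoly (c k)) *ᵥ ξ ≤ 0) :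
    c = 0 := by
  obtain ⟨L, hL⟩ := exists_isDualFamily_shiftMatrix (σ := σ) D
  have h0 := h _ (Pi.single ⟨[], Nat.zero_le D⟩ 1) (shiftMatrix_isSymm D)
  rw [map_sum, Matrix.sum_mulVec, dotProduct_sum] at h0
  simp only [dotProduct_lift_star_mul_self (shiftMatrix_isSymm D)] at h0
  have h1 := (Finset.sum_eq_zero_iff_of_nonneg fun k _ => by
    exact Finset.sum_nonneg fun i _ => mul_self_nonneg _).1
      (le_antisymm h0 (Finset.sum_nonneg fun k _ => Finset.sum_nonneg fun i _ =>
        mul_self_nonneg _))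
  ext k v
  rw [← hL.coeff_eq (c k) v, dotProduct_self_eq_zero.1 (h1 k (Finset.mem_univ k))]
  simp

theorem Matrix.PosSemidef.exists_eq_transpose_mul_self {G : Matrix ι ι ℝ} (hG : G.PosSemidef) :
    ∃ R : Matrix ι ι ℝ, G = Rᵀ * R := by
  open scoped MatrixOrder in
  obtain ⟨R, hR⟩ := CStarAlgebra.nonneg_iff_eq_star_mul_self.mp hG.nonneg
  exact ⟨R, hR⟩

omit [DecidableEq σ] in
theorem shortPoly_repr {D : ℕ} {p : FreeAlgebra ℝ σ}
    (hD : ∀ w ∈ ((wordBasis σ).repr p).support, w.length ≤ D) :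
    shortPoly (D := D) (fun w => (wordBasis σ).repr p w.1) = p := by
  conv_rhs => rw [← (wordBasis σ).linearCombination_repr p,
    Finsupp.linearCombination_apply, Finsupp.sum]
  symm
  refine Finset.sum_bij_ne_zero (fun w hw _ => ⟨w, hD w hw⟩) (fun _ _ _ => Finset.mem_univ _)
    (fun _ _ _ _ _ _ h => congrArg Subtype.val h) (fun w _ hw => ?_) (fun _ _ _ => rfl)
  exact ⟨w.1, Finsupp.mem_support_iff.2 (left_ne_zero_of_smul hw), hw, rfl⟩

theorem eq_zero_of_sum_star_mul_self_eq_zero {m : ℕ} {q : Fin m → FreeAlgebra ℝ σ}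
    (h : ∑ i, star (q i) * q i = 0) (i : Fin m) : q i = 0 := by
  let D := Finset.univ.sup fun i => ((wordBasis σ).repr (q i)).support.sup List.length
  have hD : ∀ i, ∀ w ∈ ((wordBasis σ).repr (q i)).support, w.length ≤ D := fun i w hw =>
    (Finset.le_sup (f := List.length) hw).trans
      (Finset.le_sup (f := fun i => ((wordBasis σ).repr (q i)).support.sup List.length)
        (Finset.mem_univ i))
  have h0 := eq_zero_of_sum_star_mul_self_nonpos
    (fun i (w : ShortWord σ D) => (wordBasis σ).repr (q i) w.1) fun M ξ _ => by
      simp only [shortPoly_repr (hD _), h]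
      simp
  rw [← shortPoly_repr (hD i), congrFun h0 i]
  simp [shortPoly]

/-- The construction of Gelfand, Naimark and Segal for a functional on the free algebra that is
positive definite on the span of the short words. The letters act by left multiplication
followed by orthogonal projection to this span, so that the action of a short word on the empty
word is not affected by the truncation. -/
theorem exists_isSymm_eq_functional {D : ℕ} (φ : FreeAlgebra ℝ σ →ₗ[ℝ] ℝ)
    (hstar : ∀ q, φ (star q) = φ q)
    (hpos : ∀ c : ShortWord σ D → ℝ, c ≠ 0 → 0 < φ (gramMap σ D (vecMulVec c c))) :
    ∃ (M : σ → Matrix (ShortWord σ D) (ShortWord σ D) ℝ) (ξ : ShortWord σ D → ℝ),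
      (∀ l, (M l).IsSymm) ∧
      ∀ w : List σ, w.length ≤ D → ξ ⬝ᵥ (w.map M).prod *ᵥ ξ = φ (wordBasis σ w) := by
  obtain ⟨G, hG⟩ : ∃ G : Matrix (ShortWord σ D) (ShortWord σ D) ℝ,
      ∀ v w, G v w = φ (wordBasis σ (v.1.reverse ++ w.1)) := ⟨fun _ _ => _, fun _ _ => rfl⟩
  have hGpos : G.PosDef := by
    refine .of_dotProduct_mulVec_pos ?_ fun c hc => ?_
    · ext v w
      rw [conjTranspose_apply, star_trivial, hG, hG, ← hstar, star_wordBasis,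
        List.reverse_append, List.reverse_reverse]
    · have h : star c ⬝ᵥ G *ᵥ c = φ (gramMap σ D (vecMulVec c c)) := ?_
      · rw [h]
        exact hpos c hc
      simp [gramMap, dotProduct, Matrix.mulVec, vecMulVec_apply, hG, Finset.mul_sum, mul_assoc,
        mul_comm]
  obtain ⟨R, hR⟩ := hGpos.posSemidef.exists_eq_transpose_mul_self
  have hdet : IsUnit R.det := by
    have := hGpos.det_pos.ne'
    rw [hR, Matrix.det_mul, Matrix.det_transpose] at this
    exact isUnit_iff_ne_zero.2 (left_ne_zero_of_mul this)
  obtain ⟨S, hSapp⟩ : ∃ S : σ → Matrix (ShortWord σ D) (ShortWord σ D) ℝ,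
      ∀ l v w, S l v w = φ (wordBasis σ (v.1.reverse ++ l :: w.1)) :=
    ⟨fun _ _ _ => _, fun _ _ _ => rfl⟩
  have hS : ∀ l, (S l).IsSymm := by
    intro l
    ext v w
    rw [transpose_apply, hSapp, hSapp, ← hstar, star_wordBasis]
    simp
  let M : σ → Matrix (ShortWord σ D) (ShortWord σ D) ℝ := fun l => R⁻¹ᵀ * S l * R⁻¹ᵀᵀ
  let e : ShortWord σ D → ShortWord σ D → ℝ := fun w => Pi.single w 1
  have hstep : ∀ (l : σ) (w : List σ) (h : (l :: w).length ≤ D),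
      M l *ᵥ (R *ᵥ e ⟨w, by simp at h; omega⟩) = R *ᵥ e ⟨l :: w, h⟩ := by
    intro l w h
    have hcol : S l *ᵥ e ⟨w, by simp at h; omega⟩ = G *ᵥ e ⟨l :: w, h⟩ := by
      ext v
      simp [e, hSapp, hG]
    calc M l *ᵥ (R *ᵥ e ⟨w, _⟩) = R⁻¹ᵀ *ᵥ (S l *ᵥ ((R⁻¹ * R) *ᵥ e ⟨w, _⟩)) := by
          simp only [M, transpose_transpose, Matrix.mulVec_mulVec, Matrix.mul_assoc]
      _ = (R⁻¹ᵀ * Rᵀ) *ᵥ (R *ᵥ e ⟨l :: w, h⟩) := by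
          rw [Matrix.nonsing_inv_mul R hdet, Matrix.one_mulVec, hcol, hR]
          simp only [Matrix.mulVec_mulVec, Matrix.mul_assoc]
      _ = R *ᵥ e ⟨l :: w, h⟩ := by
          rw [← Matrix.transpose_mul, Matrix.mul_nonsing_inv R hdet, Matrix.transpose_one,
            Matrix.one_mulVec]
  have hword : ∀ (w : List σ) (h : w.length ≤ D),
      (w.map M).prod *ᵥ (R *ᵥ e ⟨[], Nat.zero_le D⟩) = R *ᵥ e ⟨w, h⟩ := by
    intro w
    induction w with
    | nil => intro h; simp
    | cons l w ih =>
      intro h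
      rw [List.map_cons, List.prod_cons, ← Matrix.mulVec_mulVec,
        ih (by simp at h; omega), hstep l w h]
  refine ⟨M, R *ᵥ e ⟨[], Nat.zero_le D⟩, fun l => (hS l).conj_transpose _, fun w hw => ?_⟩
  rw [hword w hw, Matrix.dotProduct_mulVec, Matrix.vecMul_mulVec, ← hR]
  simp [e, hG]

/-- The positive semidefinite matrices of trace one form a compact set. -/
theorem isCompact_posSemidef_trace_one :
    IsCompact {G : Matrix ι ι ℝ | G.PosSemidef ∧ G.trace = 1} := by
  have hK : IsCompact {R : Matrix ι ι ℝ | (Rᵀ * R).trace = 1} := by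
    have hbox : IsCompact (Set.univ.pi fun _ => Set.univ.pi fun _ => Set.Icc (-1 : ℝ) 1 :
        Set (Matrix ι ι ℝ)) :=
      isCompact_univ_pi fun _ => isCompact_univ_pi fun _ => isCompact_Icc
    refine hbox.of_isClosed_subset (isClosed_eq (by fun_prop) continuous_const)
      fun (R : Matrix ι ι ℝ) hR => ?_
    refine Set.mem_univ_pi.2 fun i => Set.mem_univ_pi.2 fun j => ?_
    have h1 : (Rᵀ * R).trace = 1 := hR
    simp only [Matrix.trace, Matrix.diag, Matrix.mul_apply, Matrix.transpose_apply] at h1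
    have h2 : R i j * R i j ≤ 1 := by
      rw [← h1]
      exact (Finset.single_le_sum (f := fun i => R i j * R i j)
        (fun _ _ => mul_self_nonneg _) (Finset.mem_univ i)).trans
        (Finset.single_le_sum (f := fun j => ∑ i, R i j * R i j)
          (fun _ _ => Finset.sum_nonneg fun _ _ => mul_self_nonneg _) (Finset.mem_univ j))
    exact abs_le.1 ((sq_le_one_iff_abs_le_one _).1 (by rwa [sq]))
  convert hK.image (f := fun R : Matrix ι ι ℝ => Rᵀ * R) (by fun_prop) using 1
  ext G
  constructor
  · rintro ⟨hG, htr⟩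
    obtain ⟨R, rfl⟩ := hG.exists_eq_transpose_mul_self
    exact ⟨R, htr, rfl⟩
  · rintro ⟨R, hR, rfl⟩
    exact ⟨posSemidef_conjTranspose_mul_self R, hR⟩

omit [DecidableEq σ] in
theorem star_gramMap {D : ℕ} (G : Matrix (ShortWord σ D) (ShortWord σ D) ℝ) :
    star (gramMap σ D G) = gramMap σ D Gᵀ := by
  simp only [gramMap, LinearMap.coe_mk, AddHom.coe_mk, star_sum, FreeAlgebra.star_smul_real,
    star_wordBasis, List.reverse_append, List.reverse_reverse, Matrix.transpose_apply]
  exact Finset.sum_comm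

/-- If no multiple of `p` is a non-trivial sum of squares, then a functional that is positive
definite on squares is negative at `p`. -/
theorem exists_functional_neg {D : ℕ} {p : FreeAlgebra ℝ σ} (hp : star p = p) (hp0 : p ≠ 0)
    {G₀ : Matrix (ShortWord σ D) (ShortWord σ D) ℝ} (hG₀ : gramMap σ D G₀ = p)
    (hsos : ∀ (R : Matrix (ShortWord σ D) (ShortWord σ D) ℝ) (s : ℝ),
      gramMap σ D (Rᵀ * R) = s • p → R = 0) :
    ∃ φ : FreeAlgebra ℝ σ →ₗ[ℝ] ℝ, (∀ q, φ (star q) = φ q) ∧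
      (∀ c : ShortWord σ D → ℝ, c ≠ 0 → 0 < φ (gramMap σ D (vecMulVec c c))) ∧ φ p < 0 := by
  let B := ShortWord σ D
  let S := {G : Matrix B B ℝ | G.PosSemidef ∧ G.trace = 1}
  let T : Submodule ℝ (Matrix B B ℝ) := (ℝ ∙ p).comap (gramMap σ D)
  have hS : IsCompact S := isCompact_posSemidef_trace_one
  have hSconv : Convex ℝ S := by
    rintro G ⟨hG, hG1⟩ G' ⟨hG', hG1'⟩ a b ha hb hab
    exact ⟨(hG.smul ha).add (hG'.smul hb), by simp [hG1, hG1', hab]⟩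
  have hdisj : Disjoint S (T : Set (Matrix B B ℝ)) := by
    refine Set.disjoint_left.2 fun G hG hT => ?_
    obtain ⟨s, hs⟩ := Submodule.mem_span_singleton.1 (Submodule.mem_comap.1 hT)
    obtain ⟨R, rfl⟩ := hG.1.exists_eq_transpose_mul_self
    have hR := hsos R s hs.symm
    have htr := hG.2
    simp [hR] at htr
  have : LocallyConvexSpace ℝ (Matrix B B ℝ) :=
    inferInstanceAs (LocallyConvexSpace ℝ (B → B → ℝ))
  obtain ⟨f, u, v, hfS, huv, hfT⟩ := geometric_hahn_banach_compact_closed hSconv hS T.convex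
    T.closed_of_finiteDimensional hdisj
  have hu : u < 0 := huv.trans (by simpa using hfT 0 T.zero_mem)
  have hT0 : ∀ G ∈ T, f G = 0 := by
    intro G hG
    by_contra hne
    have := hfT ((v / f G) • G) (T.smul_mem _ hG)
    rw [map_smul, smul_eq_mul, div_mul_cancel₀ _ hne] at this
    exact lt_irrefl _ this
  obtain ⟨ψ, hψ⟩ : ∃ ψ : FreeAlgebra ℝ σ →ₗ[ℝ] ℝ, ∀ G, ψ (gramMap σ D G) = f G := by
    have : f.toLinearMap ∈ LinearMap.range (gramMap σ D).dualMap := by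
      rw [LinearMap.range_dualMap_eq_dualAnnihilator_ker, Submodule.mem_dualAnnihilator]
      intro G hG
      refine hT0 G ?_
      simp only [T, Submodule.mem_comap, LinearMap.mem_ker.1 hG, Submodule.zero_mem]
    obtain ⟨ψ, hψ⟩ := this
    exact ⟨ψ, fun G => LinearMap.congr_fun hψ G⟩
  have hψp : ψ p = 0 := by
    rw [← hG₀, hψ]
    exact hT0 _ (Submodule.mem_comap.2 (by
      rw [hG₀]
      exact Submodule.mem_span_singleton_self p))
  obtain ⟨χ, hχ⟩ : ∃ χ : FreeAlgebra ℝ σ →ₗ[ℝ] ℝ, 0 < χ p := by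
    obtain ⟨w, hw⟩ := Finsupp.ne_iff.1
      (fun h => hp0 ((wordBasis σ).repr.map_eq_zero_iff.1 h) : (wordBasis σ).repr p ≠ 0)
    exact ⟨((wordBasis σ).repr p w) • (wordBasis σ).coord w, by
      simpa using mul_self_pos.2 hw⟩
  -- Strict positivity on the compact set `S` survives the subtraction of a small multiple of `χ`.
  obtain ⟨K, hK⟩ := hS.exists_bound_of_continuousOn (f := fun G => χ (gramMap σ D G))
    (LinearMap.continuous_of_finiteDimensional (χ ∘ₗ gramMap σ D)).continuousOn
  let ε := -u / (|K| + 1)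
  have hε : 0 < ε := div_pos (neg_pos.2 hu) (by positivity)
  let φ₀ : FreeAlgebra ℝ σ →ₗ[ℝ] ℝ := -ψ - ε • χ
  have hφS : ∀ G ∈ S, 0 < φ₀ (gramMap σ D G) := by
    intro G hG
    have h1 : χ (gramMap σ D G) ≤ |K| :=
      (le_abs_self _).trans ((hK G hG).trans (le_abs_self K))
    have h2 : ε * (|K| + 1) = -u := div_mul_cancel₀ _ (by positivity)
    have h3 : ε * χ (gramMap σ D G) ≤ ε * |K| := mul_le_mul_of_nonneg_left h1 hε.le
    have h4 := hfS G hG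
    simp only [φ₀, LinearMap.sub_apply, LinearMap.neg_apply, LinearMap.smul_apply, hψ,
      smul_eq_mul]
    linarith
  have hφpos : ∀ c : B → ℝ, c ≠ 0 → 0 < φ₀ (gramMap σ D (vecMulVec c c)) := by
    intro c hc
    have hτ : 0 < c ⬝ᵥ c := by
      have := dotProduct_star_self_pos_iff.2 hc
      rwa [star_trivial] at this
    have hmem : (c ⬝ᵥ c)⁻¹ • vecMulVec c c ∈ S := by
      refine ⟨PosSemidef.smul ?_ (inv_pos.2 hτ).le, ?_⟩
      · simpa using posSemidef_vecMulVec_self_star c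
      · rw [Matrix.trace_smul, Matrix.trace_vecMulVec, smul_eq_mul, inv_mul_cancel₀ hτ.ne']
    have := hφS _ hmem
    rw [map_smul, map_smul, smul_eq_mul] at this
    exact pos_of_mul_pos_right this (inv_pos.2 hτ).le
  refine ⟨(2⁻¹ : ℝ) • (φ₀ + φ₀ ∘ₗ starLinear σ), fun q => ?_, fun c hc => ?_, ?_⟩
  · have : ∀ r, starLinear σ r = star r := fun _ => rfl
    simp [this, add_comm]
  · have h1 := hφpos c hc
    have h2 : starLinear σ (gramMap σ D (vecMulVec c c)) = gramMap σ D (vecMulVec c c) := by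
      refine (star_gramMap _).trans ?_
      rw [Matrix.transpose_vecMulVec]
    simp only [LinearMap.smul_apply, LinearMap.add_apply, LinearMap.comp_apply, h2, smul_eq_mul]
    linarith
  · have h2 : starLinear σ p = p := hp
    simp only [LinearMap.smul_apply, LinearMap.add_apply, LinearMap.comp_apply, h2, smul_eq_mul]
    simp only [φ₀, LinearMap.sub_apply, LinearMap.neg_apply, LinearMap.smul_apply, hψp,
      smul_eq_mul]
    have := mul_pos hε hχ
    linarith

/-- Helton's theorem: a symmetric polynomial in non-commuting variables whose values at tuples of
symmetric matrices are all positive semidefinite is a sum of squares. -/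
theorem exists_eq_sum_star_mul_self {p : FreeAlgebra ℝ σ} (hp : star p = p)
    (hpos : ∀ (ι : Type) [Fintype ι] [DecidableEq ι] (M : σ → Matrix ι ι ℝ),
      (∀ l, (M l).IsSymm) → (FreeAlgebra.lift ℝ M p).PosSemidef) :
    ∃ (m : ℕ) (q : Fin m → FreeAlgebra ℝ σ), p = ∑ i, star (q i) * q i := by
  by_cases hp0 : p = 0
  · exact ⟨0, fun _ => 0, by simp [hp0]⟩
  let D := ((wordBasis σ).repr p).support.sup List.length
  have hD : ∀ w ∈ ((wordBasis σ).repr p).support, w.length ≤ D := fun w hw =>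
    Finset.le_sup (f := List.length) hw
  have hG₀ : gramMap σ D (fun v w => if v.1 = [] then (wordBasis σ).repr p w.1 else 0) = p := by
    have hsum : ∀ v : ShortWord σ D, ∑ w : ShortWord σ D,
        (if v.1 = [] then (wordBasis σ).repr p w.1 else 0) • wordBasis σ (v.1.reverse ++ w.1) =
        if v = ⟨[], Nat.zero_le D⟩ then p else 0 := by
      intro v
      by_cases hv : v.1 = []
      · rw [if_pos (Subtype.ext hv)]
        simp only [hv, if_true, List.reverse_nil, List.nil_append]
        exact shortPoly_repr hD
      · rw [if_neg fun h => hv (congrArg Subtype.val h)]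
        simp [hv]
    simp only [gramMap, LinearMap.coe_mk, AddHom.coe_mk, hsum]
    simp
  by_cases hsos : ∃ (R : Matrix (ShortWord σ D) (ShortWord σ D) ℝ) (s : ℝ),
      gramMap σ D (Rᵀ * R) = s • p ∧ R ≠ 0
  · obtain ⟨R, s, hs, hR⟩ := hsos
    rw [gramMap_transpose_mul_self] at hs
    have hs0 : 0 < s := by
      by_contra hneg
      refine hR (eq_zero_of_sum_star_mul_self_nonpos R fun M ξ hM => ?_)
      have := (hpos _ M hM).dotProduct_mulVec_nonneg ξ
      rw [star_trivial] at this
      rw [hs, map_smul, Matrix.smul_mulVec, dotProduct_smul, smul_eq_mul]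
      exact mul_nonpos_of_nonpos_of_nonneg (not_lt.1 hneg) this
    refine ⟨Fintype.card (ShortWord σ D), fun i =>
      √(s⁻¹) • shortPoly (R ((Fintype.equivFin _).symm i)), ?_⟩
    simp only [FreeAlgebra.star_smul_real, smul_mul_smul_comm,
      Real.mul_self_sqrt (inv_pos.2 hs0).le]
    rw [← Finset.smul_sum, (Fintype.equivFin (ShortWord σ D)).symm.sum_comp
      (fun k => star (shortPoly (R k)) * shortPoly (R k)), hs, smul_smul,
      inv_mul_cancel₀ hs0.ne', one_smul]
  · push Not at hsos
    obtain ⟨φ, hstar, hφ, hneg⟩ := exists_functional_neg hp hp0 hG₀ hsos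
    obtain ⟨M, ξ, hM, hMw⟩ := exists_isSymm_eq_functional φ hstar hφ
    have h1 := (hpos _ M hM).dotProduct_mulVec_nonneg ξ
    have h2 : ξ ⬝ᵥ FreeAlgebra.lift ℝ M p *ᵥ ξ = φ p := by
      conv_rhs => rw [← (wordBasis σ).linearCombination_repr p,
        Finsupp.linearCombination_apply, Finsupp.sum, map_sum]
      rw [lift_eq_sum, Finsupp.sum, Matrix.sum_mulVec, dotProduct_sum]
      refine Finset.sum_congr rfl fun w hw => ?_
      rw [Matrix.smul_mulVec, dotProduct_smul, hMw w (hD w hw), map_smul]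
    rw [star_trivial, h2] at h1
    exact absurd hneg (not_lt.2 h1)

end SumOfSquares

/-! ### The Hessian at points of the domain -/

section Hessian

open Matrix Polynomial

variable {g : ℕ}

/-- The matrices that are substituted for the letters in the evaluation at `(A, X)`. -/
def tupleLetters {n : ℕ} (A X : SymTuple g n) : Fin g ⊕ Fin g → Matrix (Fin n) (Fin n) ℝ :=
  Sum.elim (fun j => (A j : Matrix (Fin n) (Fin n) ℝ)) fun j => (X j : Matrix (Fin n) (Fin n) ℝ)

theorem tupleLetters_isSymm {n : ℕ} (A X : SymTuple g n) (l : Fin g ⊕ Fin g) :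
    (tupleLetters A X l).IsSymm := by
  cases l with
  | inl j => exact (A j).2
  | inr j => exact (X j).2

theorem exists_tupleLetters_eq {n : ℕ} {M : Fin g ⊕ Fin g → Matrix (Fin n) (Fin n) ℝ}
    (hM : ∀ l, (M l).IsSymm) : ∃ A X : SymTuple g n, tupleLetters A X = M :=
  ⟨fun j => ⟨M (Sum.inl j), hM _⟩, fun j => ⟨M (Sum.inr j), hM _⟩, by
    funext l
    cases l <;> rfl⟩

theorem tupleLetters_add_smul {n : ℕ} (A X H : SymTuple g n) (t : ℝ) :
    tupleLetters A (X + t • H) = fun l => tupleLetters A X l + t • tupleLetters 0 H l := by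
  funext l
  cases l <;> simp [tupleLetters]

theorem exists_add_smul_mem {U : NCDomain g} (hU : U.IsOpen) {n : ℕ} {X : SymTuple g n}
    (hX : X ∈ U.level n) (H : SymTuple g n) :
    ∃ ε > 0, ∀ t : ℝ, |t| < ε → X + t • H ∈ U.level n := by
  have hc : Continuous fun t : ℝ => X + t • H := by fun_prop
  obtain ⟨ε, hε, h⟩ := Metric.isOpen_iff.1 ((hU n).preimage hc) 0 (by simpa using hX)
  exact ⟨ε, hε, fun t ht => h (by simpa using ht)⟩

/-- Convexity near a point of an open domain makes the second-order term of the restriction to any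
line through that point positive. -/
theorem hessian_nonneg {p : NCPoly g} {U : NCDomain g} (hU : U.IsOpen)
    (hconv : p.ConvexInXOn ((NCDomain.all g).prod U)) {n : ℕ} (A : SymTuple g n)
    {X : SymTuple g n} (hX : X ∈ U.level n) (H : SymTuple g n) (ξ : Fin n → ℝ) :
    0 ≤ ξ ⬝ᵥ coeffMatrix 2
      (FreeAlgebra.lift ℝ (pencil (tupleLetters A X) (tupleLetters 0 H)) p) *ᵥ ξ := by
  obtain ⟨f, hf, hfc⟩ := exists_polynomial_quadraticForm
    (FreeAlgebra.lift ℝ (pencil (tupleLetters A X) (tupleLetters 0 H)) p) ξ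
  obtain ⟨ε, hε, hmem⟩ := exists_add_smul_mem hU hX H
  have hev : ∀ t, f.eval t = ξ ⬝ᵥ p.evalAt A (X + t • H) *ᵥ ξ := by
    intro t
    rw [hf, lift_pencil_map_eval, ← tupleLetters_add_smul]
    rfl
  rw [← hfc]
  refine Polynomial.coeff_two_nonneg hε fun t ht htε => ?_
  have hseg : ∀ s : ℝ, s • (X + t • H) + (1 - s) • (X + (-t) • H) =
      X + ((2 * s - 1) * t) • H := by
    intro s
    module
  have hpsd := hconv n A (X + t • H) (X + (-t) • H) (fun s hs0 hs1 => by
    rw [hseg]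
    refine ⟨Set.mem_univ _, hmem _ ?_⟩
    rw [abs_mul, abs_of_pos ht]
    have : |2 * s - 1| ≤ 1 := abs_le.2 ⟨by linarith, by linarith⟩
    nlinarith) (1 / 2) (by norm_num) (by norm_num)
  have h0 := hpsd.dotProduct_mulVec_nonneg ξ
  rw [star_trivial, hseg, Matrix.sub_mulVec, Matrix.add_mulVec, Matrix.smul_mulVec,
    Matrix.smul_mulVec, dotProduct_sub, dotProduct_add, dotProduct_smul, dotProduct_smul,
    ← hev, ← hev, ← hev] at h0
  norm_num at h0
  linarith

theorem NCDomain.nonempty_level_mul (U : NCDomain g) {n : ℕ} (h : (U.level n).Nonempty)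
    {k : ℕ} (hk : 0 < k) : (U.level (k * n)).Nonempty := by
  induction k, hk using Nat.le_induction with
  | base =>
    rw [Nat.one_mul]
    exact h
  | succ k _ ih =>
    rw [Nat.succ_mul]
    exact ⟨_, U.directSum_mem ih.some_mem h.some_mem⟩

/-- Inside an open domain there are points at which the short words act freely on some vector. -/
theorem exists_mem_level_isDualFamily {U : NCDomain g} (hU : U.IsOpen) {n : ℕ} (hn : 0 < n)
    (hne : (U.level n).Nonempty) (D : ℕ) :
    ∃ (N : ℕ) (A X : SymTuple g N) (ξ : Fin N → ℝ) (L : List (Fin g ⊕ Fin g) → Fin N → ℝ),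
      X ∈ U.level N ∧ IsDualFamily D (tupleLetters A X) ξ L := by
  let k := Fintype.card (ShortWord (Fin g ⊕ Fin g) D)
  have hk : 0 < k := Fintype.card_pos_iff.2 ⟨⟨[], Nat.zero_le D⟩⟩
  obtain ⟨X₁, hX₁⟩ := U.nonempty_level_mul hne hk
  obtain ⟨M, ξ, L, hM, hL⟩ := exists_isSymm_isDualFamily (κ := Fin (k * n)) D
    (by simpa [k] using Nat.le_mul_of_pos_right k hn)
  obtain ⟨A, X, rfl⟩ := exists_tupleLetters_eq hM
  obtain ⟨ε, hε, hmem⟩ := exists_add_smul_mem hU hX₁ (X - X₁)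
  have hL1 : IsDualFamily D
      (fun l => tupleLetters A X₁ l + tupleLetters 0 (X - X₁) l) ξ L := by
    convert hL using 1
    have := tupleLetters_add_smul A X₁ (X - X₁) 1
    simpa using this.symm
  obtain ⟨t, ht, htε, L', hL'⟩ := hL1.exists_small hε
  rw [← tupleLetters_add_smul] at hL'
  exact ⟨k * n, A, X₁ + t • (X - X₁), ξ, L', hmem t (by rwa [abs_of_pos ht]), hL'⟩

end Hessian

/-! ### Degree in the convex variables -/

section Degree

open Matrix Polynomial

variable {g : ℕ}

/-- The degree in `x` of a word, for words given as lists. -/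
def degX (w : List (Fin g ⊕ Fin g)) : ℕ := w.countP Sum.isRight

@[simp] theorem degX_nil : degX ([] : List (Fin g ⊕ Fin g)) = 0 :=
  rfl

@[simp] theorem degX_append (v w : List (Fin g ⊕ Fin g)) : degX (v ++ w) = degX v + degX w := by
  simp [degX]

@[simp] theorem degX_reverse (w : List (Fin g ⊕ Fin g)) : degX w.reverse = degX w := by
  simp [degX]

@[simp] theorem degX_cons_inl (j : Fin g) (w : List (Fin g ⊕ Fin g)) :
    degX (Sum.inl j :: w) = degX w := by
  simp [degX]

@[simp] theorem degX_cons_inr (j : Fin g) (w : List (Fin g ⊕ Fin g)) :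
    degX (Sum.inr j :: w) = degX w + 1 :=
  List.countP_cons_of_pos rfl

theorem NCPoly.degXLE_iff (p : NCPoly g) (d : ℕ) :
    p.DegXLE d ↔ ∀ w, (wordBasis _).repr p w ≠ 0 → degX w ≤ d :=
  ⟨fun h w hw => h (FreeMonoid.ofList w) ((p.mem_words_iff _).2 hw),
    fun h w hw => h w.toList ((p.mem_words_iff w).1 hw)⟩

theorem NCPoly.isLinearInX_iff (p : NCPoly g) :
    p.IsLinearInX ↔ ∀ w, (wordBasis _).repr p w ≠ 0 → degX w = 1 :=
  ⟨fun h w hw => h (FreeMonoid.ofList w) ((p.mem_words_iff _).2 hw),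
    fun h w hw => h w.toList ((p.mem_words_iff w).1 hw)⟩

/-- The part of a polynomial that is homogeneous of degree `k` in `x`. -/
noncomputable def xPart (k : ℕ) : NCPoly g →ₗ[ℝ] NCPoly g :=
  (wordBasis _).constr ℝ fun w => if degX w = k then wordBasis _ w else 0

theorem xPart_wordBasis (k : ℕ) (w : List (Fin g ⊕ Fin g)) :
    xPart k (wordBasis _ w) = if degX w = k then wordBasis _ w else 0 :=
  (wordBasis _).constr_basis ℝ _ w

theorem repr_xPart (k : ℕ) (p : NCPoly g) (w : List (Fin g ⊕ Fin g)) :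
    (wordBasis _).repr (xPart k p) w = if degX w = k then (wordBasis _).repr p w else 0 := by
  have h : (Finsupp.lapply w ∘ₗ (wordBasis (Fin g ⊕ Fin g)).repr.toLinearMap) ∘ₗ xPart k =
      (if degX w = k then (1 : ℝ) else 0) •
        (Finsupp.lapply w ∘ₗ (wordBasis _).repr.toLinearMap) := by
    refine (wordBasis _).ext fun v => ?_
    simp only [LinearMap.comp_apply, xPart_wordBasis, LinearMap.smul_apply]
    by_cases hvw : v = w
    · subst hvw
      split_ifs <;> simp
    · split_ifs <;> simp [hvw]
  have h2 := LinearMap.congr_fun h p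
  split_ifs at h2 ⊢ <;> simpa using h2

theorem xPart_star (k : ℕ) (p : NCPoly g) : xPart k (star p) = star (xPart k p) := by
  refine (wordBasis _).repr.injective (Finsupp.ext fun w => ?_)
  simp only [repr_xPart, repr_star, degX_reverse]

theorem xPart_mul (k : ℕ) (p q : NCPoly g) :
    xPart k (p * q) =
      ∑ ij ∈ Finset.HasAntidiagonal.antidiagonal k, xPart ij.1 p * xPart ij.2 q := by
  have h : (LinearMap.mul ℝ (NCPoly g)).compr₂ (xPart k) =
      ∑ ij ∈ Finset.HasAntidiagonal.antidiagonal k,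
        (LinearMap.mul ℝ (NCPoly g)).compl₁₂ (xPart ij.1) (xPart ij.2) := by
    refine (wordBasis _).ext fun v => (wordBasis _).ext fun w => ?_
    simp only [LinearMap.compr₂_apply, LinearMap.mul_apply', ← wordBasis_append,
      LinearMap.sum_apply, LinearMap.compl₁₂_apply, xPart_wordBasis, degX_append]
    by_cases hk : degX v + degX w = k
    · rw [Finset.sum_eq_single_of_mem (degX v, degX w)
        (Finset.HasAntidiagonal.mem_antidiagonal.2 hk)]
      · simp [hk, wordBasis_append]
      · rintro ⟨i, j⟩ - hij
        by_cases hi : degX v = i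
        · rw [if_neg (fun hj : degX w = j => hij (by rw [hi, hj])), mul_zero]
        · rw [if_neg hi, zero_mul]
    · rw [if_neg hk, Finset.sum_eq_zero]
      rintro ⟨i, j⟩ hij
      have hij' := Finset.HasAntidiagonal.mem_antidiagonal.1 hij
      by_cases hi : degX v = i
      · rw [if_neg (fun hj : degX w = j => hk (by rw [hi, hj]; exact hij')), mul_zero]
      · rw [if_neg hi, zero_mul]
  have h2 := LinearMap.congr_fun (LinearMap.congr_fun h p) q
  simpa using h2

theorem NCPoly.DegXLE.eq_sum_xPart {p : NCPoly g} (hp : p.DegXLE 2) :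
    p = xPart 0 p + xPart 1 p + xPart 2 p := by
  refine (wordBasis _).repr.injective (Finsupp.ext fun w => ?_)
  simp only [map_add, Finsupp.add_apply, repr_xPart]
  by_cases h : (wordBasis _).repr p w = 0
  · simp [h]
  · have := (p.degXLE_iff 2).1 hp w h
    interval_cases degX w <;> simp

end Degree

/-! ### Factorizations of words -/

section Split

variable {α : Type*} [DecidableEq α]

/-- The sum of `φ m` over all factorizations `w = r.reverse ++ m ++ s` for given non-empty words
`r` and `s`. -/
def splitSum (r s : List α) (φ : List α → ℝ) (w : List α) : ℝ :=
  ∑ k ∈ Finset.range w.length, ∑ i ∈ Finset.range (w.drop (k + 1)).length,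
    if (w.take (k + 1)).reverse = r ∧ (w.drop (k + 1)).drop i = s
    then φ ((w.drop (k + 1)).take i) else 0

theorem splitSum_eq_zero {r s : List α} {φ : List α → ℝ} {w : List α}
    (h : ∀ m, w = r.reverse ++ (m ++ s) → φ m = 0) : splitSum r s φ w = 0 := by
  refine Finset.sum_eq_zero fun k _ => Finset.sum_eq_zero fun i _ => ?_
  split_ifs with hrs
  · refine h _ ?_
    rw [← hrs.1, List.reverse_reverse, ← hrs.2, List.take_append_drop, List.take_append_drop]
  · rfl

theorem splitSum_append {r s : List α} (hr : r ≠ []) (hs : s ≠ []) (φ : List α → ℝ)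
    (m : List α) : splitSum r s φ (r.reverse ++ (m ++ s)) = φ m := by
  have hr' : 0 < r.length := List.length_pos_iff.2 hr
  have hs' : 0 < s.length := List.length_pos_iff.2 hs
  have hdrop : (r.reverse ++ (m ++ s)).drop (r.length - 1 + 1) = m ++ s := by
    rw [Nat.sub_add_cancel hr', ← List.length_reverse, List.drop_left]
  have htake : ((r.reverse ++ (m ++ s)).take (r.length - 1 + 1)).reverse = r := by
    rw [Nat.sub_add_cancel hr', ← List.length_reverse, List.take_left, List.reverse_reverse]
  rw [splitSum, Finset.sum_eq_single (r.length - 1), hdrop, htake,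
    Finset.sum_eq_single m.length, List.drop_left, List.take_left, if_pos ⟨rfl, rfl⟩]
  · intro i hi him
    refine if_neg fun h => him ?_
    have h1 := congrArg List.length h.2
    have h2 := Finset.mem_range.1 hi
    rw [List.length_drop, List.length_append] at h1
    rw [List.length_append] at h2
    omega
  · intro h
    rw [Finset.mem_range, List.length_append] at h
    omega
  · intro k hk hkr
    refine Finset.sum_eq_zero fun i _ => if_neg fun h => hkr ?_
    have h1 := congrArg List.length h.1
    have h2 := Finset.mem_range.1 hk
    rw [List.length_reverse, List.length_take] at h1
    omega
  · intro h
    rw [Finset.mem_range, List.length_append, List.length_reverse] at h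
    omega

/-- A functional `φ` that detects a single middle factor turns `splitSum` into the detection of a
single word. -/
theorem splitSum_eq_ite {r s m₀ : List α} (hr : r ≠ []) (hs : s ≠ []) {φ : List α → ℝ}
    {w : List α} (hφ : ∀ m, m.length ≤ w.length → φ m = if m = m₀ then 1 else 0) :
    splitSum r s φ w = if w = r.reverse ++ (m₀ ++ s) then 1 else 0 := by
  split_ifs with h
  · subst h
    rw [splitSum_append hr hs, hφ, if_pos rfl]
    simp only [List.length_append]
    omega
  · refine splitSum_eq_zero fun m hm => ?_
    rw [hφ m (by rw [hm]; simp only [List.length_append]; omega), if_neg]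
    rintro rfl
    exact h hm

end Split

/-! ### Convexity bounds the degree -/

section DegreeBound

open Matrix Polynomial

variable {σ ι κ : Type*} [Fintype ι] [DecidableEq ι] [Fintype κ] [DecidableEq κ]

/-- Second-order term of a word along an off-diagonal direction. On the sum of two copies of the
representation `M`, embedded by `E₁` and `E₂`, the direction is `T` from the first copy to the
second and its transpose back; `T` is described by its values `y (l :: u)` at the vectors
`u(M) ξ`. The second-order term sends the first copy to itself, and its quadratic form at `ξ` is
the sum over the ways to single out two letters of the word, the part between these letters being
evaluated at `M`. -/
theorem dotProduct_coeffMatrix_two_prod_pencil {D : ℕ}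
    {M : σ → Matrix ι ι ℝ} {M' H : σ → Matrix κ κ ℝ} {E₁ E₂ : Matrix κ ι ℝ}
    {T : σ → Matrix ι ι ℝ} {ξ : ι → ℝ}
    {y : List σ → ι → ℝ} (hM' : ∀ l, (M' l).IsSymm)
    (hE₁ : E₁ᵀ * E₁ = 1)
    (hM₁ : ∀ l, M' l * E₁ = E₁ * M l) (hM₂ : ∀ l, M' l * E₂ = E₂ * M l)
    (hH₁ : ∀ l, H l * E₁ = E₂ * T l) (hH₂ : ∀ l, H l * E₂ = E₁ * (T l)ᵀ)
    (hT : ∀ l u, (l :: u).length ≤ D → T l *ᵥ ((u.map M).prod *ᵥ ξ) = y (l :: u))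
    {w : List σ} (hw : w.length ≤ D) :
    (E₁ *ᵥ ξ) ⬝ᵥ coeffMatrix 2 ((w.map (pencil M' H)).prod) *ᵥ (E₁ *ᵥ ξ) =
      ∑ k ∈ Finset.range w.length, ∑ i ∈ Finset.range (w.drop (k + 1)).length,
        y (w.take (k + 1)).reverse ⬝ᵥ
          (((w.drop (k + 1)).take i).map M).prod *ᵥ y ((w.drop (k + 1)).drop i) := by
  let b : List σ → ι → ℝ := fun w =>
    ∑ i ∈ Finset.range w.length, ((w.take i).map M).prod *ᵥ y (w.drop i)
  have hb_cons : ∀ l w, b (l :: w) = M l *ᵥ b w + y (l :: w) := by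
    intro l w
    simp only [b, List.length_cons, Finset.sum_range_succ', List.take_succ_cons,
      List.drop_succ_cons, List.map_cons, List.prod_cons, List.take_zero, List.map_nil,
      List.prod_nil, Matrix.one_mulVec, List.drop_zero, Matrix.mulVec_sum, Matrix.mulVec_mulVec]
  have h0 : ∀ w : List σ, coeffMatrix 0 ((w.map (pencil M' H)).prod) *ᵥ (E₁ *ᵥ ξ) =
      E₁ *ᵥ ((w.map M).prod *ᵥ ξ) := by
    intro w
    induction w with
    | nil =>
      have : coeffMatrix 0 (1 : Matrix κ κ ℝ[X]) = 1 := by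
        ext i j
        simp [coeffMatrix, Matrix.one_apply, apply_ite (fun q : ℝ[X] => q.coeff 0)]
      simp [this]
    | cons l w ih =>
      rw [coeffMatrix_zero_prod_pencil_cons, ← Matrix.mulVec_mulVec, ih, Matrix.mulVec_mulVec,
        hM₁, List.map_cons, List.prod_cons]
      simp only [Matrix.mulVec_mulVec, Matrix.mul_assoc]
  have hnil : ∀ k, coeffMatrix (k + 1) (1 : Matrix κ κ ℝ[X]) = 0 := by
    intro k
    ext i j
    rw [coeffMatrix, Matrix.one_apply]
    split_ifs <;> simp [coeff_one]
  have h1 : ∀ w : List σ, w.length ≤ D →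
      coeffMatrix 1 ((w.map (pencil M' H)).prod) *ᵥ (E₁ *ᵥ ξ) = E₂ *ᵥ b w := by
    intro w
    induction w with
    | nil => simp [hnil 0, b]
    | cons l w ih =>
      intro hw
      rw [coeffMatrix_succ_prod_pencil_cons M' H 0, Matrix.add_mulVec, ← Matrix.mulVec_mulVec,
        ← Matrix.mulVec_mulVec, ih (by simp at hw; omega), h0, hb_cons, ← hT l w hw,
        Matrix.mulVec_add, Matrix.mulVec_mulVec, hM₂, Matrix.mulVec_mulVec, hH₁]
      simp only [Matrix.mulVec_mulVec, Matrix.mul_assoc]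
  -- The prefix `u` collects the letters that have been moved to the left-hand side of the product.
  have h2 : ∀ w u : List σ, w.length + u.length ≤ D →
      (E₁ *ᵥ ((u.map M).prod *ᵥ ξ)) ⬝ᵥ
        coeffMatrix 2 ((w.map (pencil M' H)).prod) *ᵥ (E₁ *ᵥ ξ) =
      ∑ k ∈ Finset.range w.length,
        y ((w.take (k + 1)).reverse ++ u) ⬝ᵥ b (w.drop (k + 1)) := by
    intro w
    induction w with
    | nil =>
      intro u _
      simp [hnil 1]
    | cons l w ih =>
      intro u hu
      rw [List.length_cons] at hu
      have hz : M' l *ᵥ (E₁ *ᵥ ((u.map M).prod *ᵥ ξ)) =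
          E₁ *ᵥ (((l :: u).map M).prod *ᵥ ξ) := by
        rw [Matrix.mulVec_mulVec, hM₁, List.map_cons, List.prod_cons]
        simp only [Matrix.mulVec_mulVec, Matrix.mul_assoc]
      have hiso : ∀ a b : ι → ℝ, (E₁ *ᵥ a) ⬝ᵥ (E₁ *ᵥ b) = a ⬝ᵥ b := by
        intro a b
        rw [Matrix.dotProduct_mulVec, Matrix.vecMul_mulVec, hE₁, Matrix.vecMul_one]
      have hsymm : ∀ a b : κ → ℝ, a ⬝ᵥ M' l *ᵥ b = (M' l *ᵥ a) ⬝ᵥ b := by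
        intro a b
        rw [Matrix.dotProduct_mulVec, ← Matrix.mulVec_transpose, (hM' l).eq]
      rw [coeffMatrix_succ_prod_pencil_cons M' H 1, Matrix.add_mulVec, ← Matrix.mulVec_mulVec,
        ← Matrix.mulVec_mulVec, dotProduct_add, hsymm, hz,
        ih (l :: u) (by rw [List.length_cons]; omega), h1 w (by omega),
        Matrix.mulVec_mulVec (b w), hH₂, ← Matrix.mulVec_mulVec, hiso,
        Matrix.dotProduct_mulVec, Matrix.vecMul_transpose,
        hT l u (by rw [List.length_cons]; omega), List.length_cons, Finset.sum_range_succ']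
      simp
  have h3 := h2 w [] (by simpa using hw)
  simp only [List.map_nil, List.prod_nil, Matrix.one_mulVec, List.append_nil] at h3
  rw [h3]
  simp only [b, dotProduct_sum]

theorem Fin.natAdd_ne_castAdd {m n : ℕ} (i : Fin n) (j : Fin m) :
    Fin.natAdd m i ≠ Fin.castAdd n j := by
  rw [Ne, Fin.ext_iff, Fin.val_natAdd, Fin.val_castAdd]
  omega

theorem directSum_mul_embMatrix_castAdd {m n : ℕ} (A : SymMat m) (B : SymMat n) :
    (SymMat.directSum A B).1 * embMatrix (Fin.castAddEmb n : Fin m ↪ Fin (m + n)) =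
      embMatrix (Fin.castAddEmb n : Fin m ↪ Fin (m + n)) * A.1 := by
  refine Matrix.ext fun i j => ?_
  rw [Matrix.mul_apply, Matrix.mul_apply, Fin.sum_univ_add]
  refine Fin.addCases (fun i => ?_) (fun i => ?_) i <;>
    simp [SymMat.directSum, embMatrix, Fin.natAdd_ne_castAdd]

theorem directSum_mul_embMatrix_natAdd {m n : ℕ} (A : SymMat m) (B : SymMat n) :
    (SymMat.directSum A B).1 * embMatrix (Fin.natAddEmb m : Fin n ↪ Fin (m + n)) =
      embMatrix (Fin.natAddEmb m : Fin n ↪ Fin (m + n)) * B.1 := by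
  refine Matrix.ext fun i j => ?_
  rw [Matrix.mul_apply, Matrix.mul_apply, Fin.sum_univ_add]
  refine Fin.addCases (fun i => ?_) (fun i => ?_) i <;>
    simp [SymMat.directSum, embMatrix, (Fin.natAdd_ne_castAdd _ _).symm]

theorem embMatrix_natAdd_transpose_mul_castAdd (m n : ℕ) :
    (embMatrix (Fin.natAddEmb m : Fin n ↪ Fin (m + n)))ᵀ *
      embMatrix (Fin.castAddEmb n : Fin m ↪ Fin (m + n)) = 0 := by
  ext i j
  simp [Matrix.mul_apply, embMatrix, Fin.natAdd_ne_castAdd]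

theorem exists_first_inr {g : ℕ} {w : List (Fin g ⊕ Fin g)} (h : 0 < degX w) :
    ∃ (u : List (Fin g ⊕ Fin g)) (i : Fin g) (v : List (Fin g ⊕ Fin g)),
      w = u ++ Sum.inr i :: v ∧ degX u = 0 := by
  induction w with
  | nil => simp at h
  | cons l w ih =>
    cases l with
    | inl j =>
      obtain ⟨u, i, v, rfl, hu⟩ := ih (by simpa using h)
      exact ⟨Sum.inl j :: u, i, v, rfl, by simpa using hu⟩
    | inr j => exact ⟨[], j, w, rfl, rfl⟩

/-- Convexity on an open domain forces degree at most two. A word of maximal degree `d > 2` is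
written as `aᵀ v b`, where `aᵀ` ends in its first `x`-letter and `b` starts with the second one.
The words `bᵀ m b` have degree at least `2 * d - 2 > d` and do not occur in `p`, so the diagonal
entry of the Hessian at `b` vanishes, while the off-diagonal entry at `a` and `b` detects the
coefficient of `aᵀ v b`. -/
theorem NCPoly.ConvexInXOn.degXLE_two {g : ℕ} {p : NCPoly g} (hp : star p = p) {U : NCDomain g}
    (hU : U.IsOpen) (hne : ∃ n : ℕ, 0 < n ∧ (U.level n).Nonempty)
    (hconv : p.ConvexInXOn ((NCDomain.all g).prod U)) : p.DegXLE 2 := by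
  rw [NCPoly.degXLE_iff]
  by_contra! hbig
  obtain ⟨w₀, hw₀, hw₀d⟩ := hbig
  set P := (wordBasis (Fin g ⊕ Fin g)).repr p with hP
  obtain ⟨ω, hωmem, hmax⟩ := Finset.exists_max_image P.support degX
    ⟨w₀, Finsupp.mem_support_iff.2 hw₀⟩
  have hd : 2 < degX ω := hw₀d.trans_le (hmax w₀ (Finsupp.mem_support_iff.2 hw₀))
  obtain ⟨u, i, v', rfl, hu⟩ := exists_first_inr (w := ω) (by omega)
  simp only [degX_append, degX_cons_inr, hu] at hd hmax
  obtain ⟨v, j, w, rfl, hv⟩ := exists_first_inr (w := v') (by omega)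
  simp only [degX_append, degX_cons_inr, hv] at hd hmax
  set a := Sum.inr i :: u.reverse with ha
  set b := Sum.inr j :: w with hb
  have hω : u ++ Sum.inr i :: (v ++ b) = a.reverse ++ (v ++ b) := by simp [ha]
  rw [hω] at hωmem
  have hadeg : degX a = 1 := by simp [ha, hu]
  have hbdeg : degX b = degX w + 1 := by simp [hb]
  have ha0 : a ≠ [] := by simp [ha]
  have hb0 : b ≠ [] := by simp [hb]
  have hab : a ≠ b := fun h => by rw [h, hbdeg] at hadeg; omega
  let D := P.support.sup List.length
  have hD : ∀ z ∈ P.support, z.length ≤ D := fun z hz => Finset.le_sup (f := List.length) hz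
  have hωD := hD _ hωmem
  simp only [List.length_append, List.length_reverse] at hωD
  obtain ⟨n, hn, hnU⟩ := hne
  obtain ⟨N, A, X, ξ, L, hX, hL⟩ := exists_mem_level_isDualFamily hU hn hnU D
  set M := tupleLetters A X with hM
  -- For `a = l :: u` the direction in the variable `l` takes `u(M) ξ` to the dual vector of `v`;
  -- for `b` in place of `a` the value is `s • ξ`. All other values are zero.
  have key : ∀ s : ℝ,
      0 ≤ (P.sum fun z c => c * splitSum a a (fun m => L v ⬝ᵥ (m.map M).prod *ᵥ L v) z) +
        s * (2 * P (a.reverse ++ (v ++ b))) := by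
    intro s
    let y : List (Fin g ⊕ Fin g) → Fin N → ℝ := fun r =>
      (if r = a then L v else 0) + if r = b then s • ξ else 0
    let T : Fin g ⊕ Fin g → Matrix (Fin N) (Fin N) ℝ := fun l =>
      ∑ r : ShortWord (Fin g ⊕ Fin g) D, vecMulVec (y (l :: r.1)) (L r.1)
    have hT : ∀ l r, (l :: r).length ≤ D → T l *ᵥ ((r.map M).prod *ᵥ ξ) = y (l :: r) := by
      intro l r hr
      have hr' : r.length ≤ D := by rw [List.length_cons] at hr; omega
      simp only [T, Matrix.sum_mulVec, Matrix.vecMulVec_mulVec]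
      rw [Finset.sum_eq_single ⟨r, hr'⟩]
      · rw [hL r r hr' hr', if_pos rfl]
        simp
      · intro r' _ hrr
        rw [hL r'.1 r r'.2 hr', if_neg fun h => hrr (Subtype.ext h)]
        simp
      · simp
    have hTinl : ∀ k, T (Sum.inl k) = 0 := by
      intro k
      simp [T, y, ha, hb]
    let E₁ : Matrix (Fin (N + N)) (Fin N) ℝ := embMatrix (Fin.castAddEmb N)
    let E₂ : Matrix (Fin (N + N)) (Fin N) ℝ := embMatrix (Fin.natAddEmb N)
    have h11 : E₁ᵀ * E₁ = 1 := embMatrix_transpose_mul _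
    have h22 : E₂ᵀ * E₂ = 1 := embMatrix_transpose_mul _
    have h21 : E₂ᵀ * E₁ = 0 := embMatrix_natAdd_transpose_mul_castAdd N N
    have h12 : E₁ᵀ * E₂ = 0 := by
      have := congrArg transpose h21
      simpa [Matrix.transpose_mul] using this
    let H : SymTuple g (N + N) := fun k =>
      ⟨E₂ * T (Sum.inr k) * E₁ᵀ + E₁ * (T (Sum.inr k))ᵀ * E₂ᵀ, by
        change Matrix.IsSymm _
        simp [Matrix.IsSymm, Matrix.transpose_mul, Matrix.mul_assoc, add_comm]⟩
    have hH : ∀ l, tupleLetters 0 H l = E₂ * T l * E₁ᵀ + E₁ * (T l)ᵀ * E₂ᵀ := by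
      rintro (k | k)
      · simp [tupleLetters, hTinl]
      · rfl
    have hess := hessian_nonneg hU hconv (A.directSum A) (U.directSum_mem hX hX) H (E₁ *ᵥ ξ)
    rw [coeffMatrix_lift, Finsupp.sum, Matrix.sum_mulVec, dotProduct_sum] at hess
    refine hess.trans_eq ?_
    have hterm : ∀ z ∈ P.support, (E₁ *ᵥ ξ) ⬝ᵥ (P z • coeffMatrix 2
        ((z.map (pencil (tupleLetters (A.directSum A) (X.directSum X))
          (tupleLetters 0 H))).prod)) *ᵥ (E₁ *ᵥ ξ) =
        P z * splitSum a a (fun m => L v ⬝ᵥ (m.map M).prod *ᵥ L v) z +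
        (s * (if z = a.reverse ++ (v ++ b) then P z else 0) +
         s * (if z = b.reverse ++ (v.reverse ++ a) then P z else 0)) := by
      intro z hz
      have hzD := hD z hz
      have haa := dotProduct_coeffMatrix_two_prod_pencil (M := M)
        (M' := tupleLetters (A.directSum A) (X.directSum X)) (H := tupleLetters 0 H)
        (E₁ := E₁) (E₂ := E₂) (T := T) (ξ := ξ) (y := y)
        (tupleLetters_isSymm _ _) h11
        (by rintro (k | k) <;> exact directSum_mul_embMatrix_castAdd _ _)
        (by rintro (k | k) <;> exact directSum_mul_embMatrix_natAdd _ _)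
        (fun l => by
          rw [hH, Matrix.add_mul, Matrix.mul_assoc _ _ E₁, Matrix.mul_assoc _ _ E₁, h11, h21]
          simp)
        (fun l => by
          rw [hH, Matrix.add_mul, Matrix.mul_assoc _ _ E₂, Matrix.mul_assoc _ _ E₂, h22, h12]
          simp) hT hzD
      rw [Matrix.smul_mulVec, dotProduct_smul, haa, smul_eq_mul]
      have hsplit : (∑ k ∈ Finset.range z.length, ∑ i ∈ Finset.range (z.drop (k + 1)).length,
          y (z.take (k + 1)).reverse ⬝ᵥ
            (((z.drop (k + 1)).take i).map M).prod *ᵥ y ((z.drop (k + 1)).drop i)) =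
          splitSum a a (fun m => L v ⬝ᵥ (m.map M).prod *ᵥ L v) z +
          s * splitSum a b (fun m => L v ⬝ᵥ (m.map M).prod *ᵥ ξ) z +
          s * splitSum b a (fun m => ξ ⬝ᵥ (m.map M).prod *ᵥ L v) z +
          s ^ 2 * splitSum b b (fun m => ξ ⬝ᵥ (m.map M).prod *ᵥ ξ) z := by
        simp only [splitSum, Finset.mul_sum, ← Finset.sum_add_distrib]
        refine Finset.sum_congr rfl fun k _ => Finset.sum_congr rfl fun i _ => ?_
        simp only [y]
        generalize (z.take (k + 1)).reverse = r
        generalize (z.drop (k + 1)).drop i = r'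
        have hne : ∀ r, r = a → r ≠ b := fun r h h' => hab (h ▸ h')
        by_cases h1 : r = a <;> by_cases h2 : r = b <;> by_cases h3 : r' = a <;>
          by_cases h4 : r' = b <;>
          first
          | exact absurd h2 (hne r h1)
          | exact absurd h4 (hne r' h3)
          | simp [h1, h2, h3, h4, hab, hab.symm, Matrix.mulVec_smul, sq, mul_assoc]
      have hbb : splitSum b b (fun m => ξ ⬝ᵥ (m.map M).prod *ᵥ ξ) z = 0 := by
        refine splitSum_eq_zero fun m hm => ?_
        have := hmax z hz
        rw [hm] at this
        simp only [degX_append, degX_reverse, hbdeg] at this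
        omega
      have h_ab := splitSum_eq_ite (r := a) (s := b) (m₀ := v) (w := z) ha0 hb0
        (φ := fun m => L v ⬝ᵥ (m.map M).prod *ᵥ ξ) fun m hm => by
          rw [hL v m (by omega) (by omega)]
          simp only [eq_comm]
      have h_ba := splitSum_eq_ite (r := b) (s := a) (m₀ := v.reverse) (w := z) hb0 ha0
        (φ := fun m => ξ ⬝ᵥ (m.map M).prod *ᵥ L v) fun m hm => by
          rw [Matrix.dotProduct_mulVec, ← Matrix.mulVec_transpose,
            transpose_prod_of_isSymm (tupleLetters_isSymm A X), dotProduct_comm,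
            hL v m.reverse (by omega) (by rw [List.length_reverse]; omega)]
          simp only [eq_comm (a := v), List.reverse_eq_iff]
      rw [hsplit, hbb, h_ab, h_ba]
      split_ifs <;> ring
    have hrev : P (b.reverse ++ (v.reverse ++ a)) = P (a.reverse ++ (v ++ b)) := by
      have h := repr_star p (a.reverse ++ (v ++ b))
      rw [hp] at h
      rw [hP, h]
      simp
    rw [Finset.sum_congr rfl hterm, Finset.sum_add_distrib, Finset.sum_add_distrib,
      ← Finset.mul_sum, ← Finset.mul_sum, Finset.sum_ite_eq', Finset.sum_ite_eq', if_pos hωmem,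
      if_pos (Finsupp.mem_support_iff.2 (hrev ▸ Finsupp.mem_support_iff.1 hωmem)), hrev,
      Finsupp.sum]
    ring
  -- An affine function of `s` that is bounded below is constant.
  have hne0 := Finsupp.mem_support_iff.1 hωmem
  set Q := P (a.reverse ++ (v ++ b))
  generalize (P.sum fun z c => c * splitSum a a (fun m => L v ⬝ᵥ (m.map M).prod *ᵥ L v) z) = C
    at key
  have h1 := key (-(C + 1) / (2 * Q))
  rw [div_mul_cancel₀ _ (mul_ne_zero two_ne_zero hne0)] at h1
  linarith

end DegreeBound

/-! ### Polynomials of degree at most two -/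

section DegreeTwo

open Matrix Polynomial

variable {g : ℕ}

theorem coeffMatrix_prod_pencil_of_degX_le {n : ℕ} (A X H : SymTuple g n)
    (w : List (Fin g ⊕ Fin g)) (k : ℕ) (hk : degX w ≤ k) :
    coeffMatrix k ((w.map (pencil (tupleLetters A X) (tupleLetters 0 H))).prod) =
      if degX w = k then (w.map (tupleLetters A H)).prod else 0 := by
  induction w generalizing k with
  | nil =>
    ext i j
    rw [List.map_nil, List.prod_nil, coeffMatrix, Matrix.one_apply]
    by_cases hk0 : k = 0
    · by_cases hij : i = j <;> simp [hk0, hij]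
    · by_cases hij : i = j <;> simp [hij, coeff_one, hk0, Ne.symm hk0]
  | cons l w ih =>
    cases l with
    | inl j =>
      rw [degX_cons_inl] at hk ⊢
      cases k with
      | zero =>
        rw [coeffMatrix_zero_prod_pencil_cons, ih 0 hk]
        simp [tupleLetters]
      | succ k =>
        rw [coeffMatrix_succ_prod_pencil_cons, ih (k + 1) hk]
        simp [tupleLetters]
    | inr j =>
      rw [degX_cons_inr] at hk ⊢
      obtain ⟨k, rfl⟩ : ∃ k', k = k' + 1 := ⟨k - 1, by omega⟩
      rw [coeffMatrix_succ_prod_pencil_cons, ih (k + 1) (by omega), ih k (by omega),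
        if_neg (by omega : degX w ≠ k + 1)]
      simp [tupleLetters]

/-- For a polynomial of degree at most two in `x`, the Hessian does not depend on the point. -/
theorem NCPoly.DegXLE.coeffMatrix_two {n : ℕ} {p : NCPoly g} (hp : p.DegXLE 2)
    (A X H : SymTuple g n) :
    coeffMatrix 2 (FreeAlgebra.lift ℝ (pencil (tupleLetters A X) (tupleLetters 0 H)) p) =
      FreeAlgebra.lift ℝ (tupleLetters A H) (xPart 2 p) := by
  have hx : xPart 2 p = ((wordBasis _).repr p).sum fun w c =>
      c • if degX w = 2 then wordBasis _ w else 0 := by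
    conv_lhs => rw [← (wordBasis _).linearCombination_repr p, Finsupp.linearCombination_apply,
      Finsupp.sum, map_sum]
    simp only [map_smul, xPart_wordBasis, Finsupp.sum]
  rw [coeffMatrix_lift, hx, Finsupp.sum, Finsupp.sum, map_sum]
  refine Finset.sum_congr rfl fun w hw => ?_
  rw [coeffMatrix_prod_pencil_of_degX_le A X H w 2
    ((p.degXLE_iff 2).1 hp w (Finsupp.mem_support_iff.1 hw)), map_smul]
  split_ifs <;> simp [lift_wordBasis]

theorem posSemidef_lift_xPart_two {p : NCPoly g} (hp : star p = p) {U : NCDomain g}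
    (hU : U.IsOpen) (hne : ∃ n : ℕ, 0 < n ∧ (U.level n).Nonempty)
    (hconv : p.ConvexInXOn ((NCDomain.all g).prod U)) (hdeg : p.DegXLE 2)
    (ι : Type) [Fintype ι] [DecidableEq ι] (M : Fin g ⊕ Fin g → Matrix ι ι ℝ)
    (hM : ∀ l, (M l).IsSymm) :
    (FreeAlgebra.lift ℝ M (xPart 2 p)).PosSemidef := by
  obtain ⟨n, hn, hnU⟩ := hne
  -- The number of copies is `card ι + 1` so that it is positive even if `ι` is empty.
  let N := (Fintype.card ι + 1) * n
  obtain ⟨X, hX⟩ := U.nonempty_level_mul hnU (Nat.succ_pos (Fintype.card ι))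
  have hcard : Fintype.card ι ≤ Fintype.card (Fin N) := by
    rw [Fintype.card_fin]
    exact (Nat.le_succ _).trans (Nat.le_mul_of_pos_right _ hn)
  obtain ⟨f⟩ := Function.Embedding.nonempty_of_card_le hcard
  obtain ⟨A, H, hAH⟩ := exists_tupleLetters_eq
    (M := fun l => embMatrix f * M l * (embMatrix f)ᵀ) fun l => (hM l).conj_transpose _
  have hbig : (FreeAlgebra.lift ℝ (tupleLetters A H) (xPart 2 p)).PosSemidef := by
    refine .of_dotProduct_mulVec_nonneg ?_ fun ξ => ?_
    · have h := lift_star_of_isSymm (tupleLetters_isSymm A H) (xPart 2 p)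
      rw [← xPart_star, hp] at h
      exact h.symm
    · rw [star_trivial, ← hdeg.coeffMatrix_two A X H]
      exact hessian_nonneg hU hconv A hX H ξ
  have hE := lift_mul_of_intertwines (M := M) (M' := tupleLetters A H) (E := embMatrix f)
    (fun l => by rw [hAH]; exact embMatrix_intertwines f (M l)) (xPart 2 p)
  have h := hbig.conjTranspose_mul_mul_same (embMatrix f)
  rwa [Matrix.mul_assoc, hE, ← Matrix.mul_assoc, conjTranspose_eq_transpose_of_trivial,
    embMatrix_transpose_mul, Matrix.one_mul] at h

/-- If a sum of squares is homogeneous of degree two in `x`, then only the parts of its terms that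
are linear in `x` contribute: the parts of degree zero vanish because their squares sum to zero. -/
theorem xPart_two_sum_star_mul_self {m : ℕ} {q : Fin m → NCPoly g} {r : NCPoly g}
    (h : xPart 2 r = ∑ i, star (q i) * q i) :
    xPart 2 r = ∑ i, star (xPart 1 (q i)) * xPart 1 (q i) := by
  have hxx : ∀ j k, xPart j (xPart k r) = if j = k then xPart k r else 0 := by
    intro j k
    refine (wordBasis _).repr.injective (Finsupp.ext fun w => ?_)
    by_cases hjk : j = k
    · subst hjk
      rw [repr_xPart, if_pos rfl, repr_xPart]
      split_ifs <;> rfl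
    · rw [if_neg hjk, repr_xPart, repr_xPart]
      split_ifs <;> simp_all
  have h0 : ∑ i, star (xPart 0 (q i)) * xPart 0 (q i) = 0 := by
    have := congrArg (xPart 0) h
    rw [hxx, if_neg (by norm_num), map_sum] at this
    rw [this]
    refine Finset.sum_congr rfl fun i _ => ?_
    simp [xPart_mul, xPart_star]
  have hq : ∀ i, xPart 0 (q i) = 0 := eq_zero_of_sum_star_mul_self_eq_zero h0
  have h2 := congrArg (xPart 2) h
  rw [hxx, if_pos rfl, map_sum] at h2
  rw [h2]
  refine Finset.sum_congr rfl fun i _ => ?_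
  rw [xPart_mul, show Finset.HasAntidiagonal.antidiagonal 2 =
    {((0 : ℕ), (2 : ℕ)), (1, 1), (2, 0)} from rfl]
  simp [xPart_star, hq]

theorem prod_tupleLetters_affine {n : ℕ} (A X Y : SymTuple g n) (t : ℝ)
    (w : List (Fin g ⊕ Fin g)) (hw : degX w ≤ 1) :
    (w.map (tupleLetters A (t • X + (1 - t) • Y))).prod =
      t • (w.map (tupleLetters A X)).prod + (1 - t) • (w.map (tupleLetters A Y)).prod := by
  have hconst : ∀ w : List (Fin g ⊕ Fin g), degX w = 0 → ∀ X Y : SymTuple g n,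
      (w.map (tupleLetters A X)).prod = (w.map (tupleLetters A Y)).prod := by
    intro w hw X Y
    congr 1
    refine List.map_congr_left fun l hl => ?_
    cases l with
    | inl j => rfl
    | inr j =>
      have := List.countP_eq_zero.1 hw _ hl
      simp at this
  induction w with
  | nil =>
    rw [List.map_nil, List.map_nil, List.map_nil, ← add_smul]
    simp
  | cons l w ih =>
    cases l with
    | inl j =>
      rw [degX_cons_inl] at hw
      simp only [List.map_cons, List.prod_cons, ih hw, Matrix.mul_add, Matrix.mul_smul]
      rfl
    | inr j =>
      have hw0 : degX w = 0 := by rw [degX_cons_inr] at hw; omega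
      simp only [List.map_cons, List.prod_cons, hconst w hw0 _ Y]
      simp [tupleLetters, Matrix.add_mul]

theorem NCPoly.DegXLE.evalAt_affine {q : NCPoly g} (hq : q.DegXLE 1) {n : ℕ}
    (A X Y : SymTuple g n) (t : ℝ) :
    q.evalAt A (t • X + (1 - t) • Y) = t • q.evalAt A X + (1 - t) • q.evalAt A Y := by
  have h : ∀ Z : SymTuple g n, q.evalAt A Z =
      ((wordBasis _).repr q).sum fun w c => c • (w.map (tupleLetters A Z)).prod := fun Z =>
    lift_eq_sum (tupleLetters A Z) q
  rw [h, h, h, Finsupp.sum, Finsupp.sum, Finsupp.sum, Finset.smul_sum, Finset.smul_sum,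
    ← Finset.sum_add_distrib]
  refine Finset.sum_congr rfl fun w hw => ?_
  rw [prod_tupleLetters_affine A X Y t w
    ((q.degXLE_iff 1).1 hq w (Finsupp.mem_support_iff.1 hw))]
  module

theorem NCPoly.evalAt_star {n : ℕ} (q : NCPoly g) (A X : SymTuple g n) :
    (star q).evalAt A X = (q.evalAt A X)ᵀ :=
  lift_star_of_isSymm (tupleLetters_isSymm A X) q

/-- For `p = L + ∑ Λᵢᵀ Λᵢ` the convexity defect is `t (1 - t) ∑ (Pᵢ - Qᵢ)ᵀ (Pᵢ - Qᵢ)`, where `Pᵢ`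
and `Qᵢ` are the values of `Λᵢ` at the end points. -/
theorem convexInXOn_of_eq_add_sum {p L : NCPoly g} {m : ℕ} {Λ : Fin m → NCPoly g}
    (hL : L.DegXLE 1) (hΛ : ∀ i, (Λ i).DegXLE 1) (h : p = L + ∑ i, star (Λ i) * Λ i)
    (W : (n : ℕ) → Set (SymTuple g n × SymTuple g n)) : p.ConvexInXOn W := by
  intro n A X Y _ t ht0 ht1
  have hev : ∀ Z : SymTuple g n, p.evalAt A Z =
      L.evalAt A Z + ∑ i, ((Λ i).evalAt A Z)ᵀ * (Λ i).evalAt A Z := by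
    intro Z
    simp only [← NCPoly.evalAt_star]
    rw [h]
    simp [NCPoly.evalAt]
  have hdefect : t • p.evalAt A X + (1 - t) • p.evalAt A Y - p.evalAt A (t • X + (1 - t) • Y) =
      ∑ i, (t * (1 - t)) • (((Λ i).evalAt A X - (Λ i).evalAt A Y)ᵀ *
        ((Λ i).evalAt A X - (Λ i).evalAt A Y)) := by
    simp only [hev, hL.evalAt_affine, (hΛ _).evalAt_affine]
    have hi : ∀ P Q : Matrix (Fin n) (Fin n) ℝ,
        (t * (1 - t)) • ((P - Q)ᵀ * (P - Q)) = t • (Pᵀ * P) + (1 - t) • (Qᵀ * Q) -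
          (t • P + (1 - t) • Q)ᵀ * (t • P + (1 - t) • Q) := by
      intro P Q
      simp only [Matrix.transpose_sub, Matrix.transpose_add, Matrix.transpose_smul,
        Matrix.add_mul, Matrix.mul_add, Matrix.sub_mul, Matrix.mul_sub, Matrix.smul_mul,
        Matrix.mul_smul]
      module
    simp only [hi, Finset.sum_sub_distrib, Finset.sum_add_distrib, ← Finset.smul_sum, smul_add]
    abel
  rw [hdefect]
  refine posSemidef_sum _ fun i _ => PosSemidef.smul ?_ (mul_nonneg ht0 (by linarith))
  exact posSemidef_conjTranspose_mul_self _

end DegreeTwo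

theorem mainTheorem1 (g : ℕ) (p : NCPoly g) (hp : star p = p)
    (U : NCDomain g) (hU : U.IsOpen) (hne : ∃ n : ℕ, 0 < n ∧ (U.level n).Nonempty)
    (hconv : p.ConvexInXOn ((NCDomain.all g).prod U)) :
    (∃ (L : NCPoly g) (m : ℕ) (Λ : Fin m → NCPoly g),
      L.DegXLE 1 ∧ (∀ i, (Λ i).IsLinearInX) ∧ p = L + ∑ i, star (Λ i) * Λ i) ∧
    p.DegXLE 2 ∧
    p.ConvexInXOn ((NCDomain.all g).prod (NCDomain.all g)) := by
  have hdeg : p.DegXLE 2 := NCPoly.ConvexInXOn.degXLE_two hp hU hne hconv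
  obtain ⟨m, q, hq⟩ := exists_eq_sum_star_mul_self (p := xPart 2 p) (by rw [← xPart_star, hp])
    (posSemidef_lift_xPart_two hp hU hne hconv hdeg)
  have hΛ : ∀ i, (xPart 1 (q i)).IsLinearInX := by
    intro i
    rw [NCPoly.isLinearInX_iff]
    intro w hw
    rw [repr_xPart] at hw
    by_contra h
    exact hw (if_neg h)
  have hL : (xPart 0 p + xPart 1 p).DegXLE 1 := by
    rw [NCPoly.degXLE_iff]
    intro w hw
    by_contra h
    rw [map_add, Finsupp.add_apply, repr_xPart, repr_xPart, if_neg (by omega),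
      if_neg (by omega)] at hw
    simp at hw
  have heq : p = (xPart 0 p + xPart 1 p) + ∑ i, star (xPart 1 (q i)) * xPart 1 (q i) := by
    rw [← xPart_two_sum_star_mul_self hq]
    exact hdeg.eq_sum_xPart
  exact ⟨⟨_, m, _, hL, hΛ, heq⟩, hdeg,
    convexInXOn_of_eq_add_sum hL (fun i w hw => (hΛ i w hw).le) heq _⟩
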